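/- For a complex number $z$ and $n\ge 1$ let $Q_n(z)=\sum_{\lambda} z^{\ell(\lambda)}$, where $\lambda$ runs over the partitions of $n$ all of whose parts are odd and $\ell(\lambda)$ is the number of parts of $\lambda$; equivalently $1+\sum_{n\ge 1}Q_n(z)q^n=\prod_{m\ \mathrm{odd}}(1-zq^m)^{-1}$. All roots below are principal branches, and $\mathrm{Li}_2(z)=\sum_{m\ge1}z^m/m^2$. Let $D=\{z\in\mathbb{C}:0<|z|<1\}$. For coprime integers $0<h\le k$ put $$L_{h,k}(z)=\frac{(k,2)}{k}\sqrt{\tfrac12\,\mathrm{Li}_2\!\left(z^{k/(k,2)}e^{2\pi i h/(k,2)}\right)}\qquad(z\in D),$$ where $(k,2)$ is the greatest common divisor. Let $[L_{p,q}]$ be the set of all $L_{h,k}$ with $\Re L_{h,k}=\Re L_{p,q}$ on all of $D$, and define the phase $$R(p,q)=\{z\in D:\ \Re L_{p,q}(z)>\Re L_{h,k}(z)\ \text{for all coprime } 0<h\le k \text{ with } L_{h,k}\notin[L_{p,q}]\}.$$ Theorem. Let $X\subset\mathbb{C}$ be compact. Below, $a_n(z)\sim b_n(z)$ means that $a_n(z)/b_n(z)\to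 1$ as $n\to\infty$, uniformly for $z\in X$. (1) If $X\subset R(1,1)$, then $$Q_n(z)\sim\sqrt[4]{\frac{\mathrm{Li}_2(z)}{32\pi^2n^3}}\;\exp\left(\sqrt{2n\,\mathrm{Li}_2(z)}\right).$$ (2) If $X\subset R(1,2)$, then $$Q_n(z)\sim(-1)^n\sqrt[4]{\frac{\mathrm{Li}_2(-z)}{32\pi^2n^3}}\;\exp\left(\sqrt{2n\,\mathrm{Li}_2(-z)}\right).$$ (3) If $X\subset R(1,4)$, then $$Q_n(z)\sim\left(i^{-n}\sqrt[4]{\frac{i-z}{i+z}}+i^{n}\sqrt[4]{\frac{i+z}{i-z}}\right)\sqrt[4]{\frac{\mathrm{Li}_2(-z^2)}{128\pi^2n^3}}\;\exp\left(\sqrt{\frac{n\,\mathrm{Li}_2(-z^2)}{2}}\right).$$ -/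

import Mathlib

open Filter Topology Complex

noncomputable section

namespace OddParts

/-- `Q n z` is the sum of `z ^ length(p)` over the partitions `p` of `n` into odd parts. -/
def Q (n : ℕ) (z : ℂ) : ℂ :=
  ∑ p ∈ Nat.Partition.odds n, z ^ Multiset.card p.parts

/-- The dilogarithm `Li₂(z) = ∑_{m ≥ 1} z ^ m / m ^ 2`, for `‖z‖ ≤ 1`. -/
def Li₂ (z : ℂ) : ℂ :=
  ∑' m : ℕ, z ^ (m + 1) / ((m : ℂ) + 1) ^ 2

/-- The domain on which the phases live: the open unit disk without its center. -/
def puncturedDisk : Set ℂ :=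
  {z : ℂ | ‖z‖ < 1 ∧ z ≠ 0}

/-- The function `L_{h,k}` of the residue class `1 mod 2`, with the principal square root:
`((k,2)/k) * sqrt ((1/2) * Li₂ (z ^ (k/(k,2)) * e ^ (2 π i h / (k,2))))`. -/
def L (h k : ℕ) (z : ℂ) : ℂ :=
  ((Nat.gcd k 2 : ℂ) / (k : ℂ)) *
    ((1 / 2 : ℂ) * Li₂ (z ^ (k / Nat.gcd k 2) *
      exp (2 * Real.pi * I * (h : ℂ) / (Nat.gcd k 2 : ℂ)))) ^ (1 / 2 : ℂ)

/-- `L_{h,k}` belongs to the class `[L_{p,q}]`: their real parts agree on the whole domain. -/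
def SameClass (h k p q : ℕ) : Prop :=
  ∀ z ∈ puncturedDisk, (L h k z).re = (L p q z).re

/-- The phase `R(p,q)`. -/
def phase (p q : ℕ) : Set ℂ :=
  {z : ℂ | z ∈ puncturedDisk ∧
    ∀ h k : ℕ, 0 < h → h ≤ k → Nat.Coprime h k → ¬ SameClass h k p q →
      (L h k z).re < (L p q z).re}

/-- `a n z ∼ b n z` as `n → ∞`, uniformly for `z ∈ X`: the quotient tends to `1` uniformly. -/
def AsympOn (X : Set ℂ) (a b : ℕ → ℂ → ℂ) : Prop :=
  TendstoUniformlyOn (fun n z => a n z / b n z) (fun _ => 1) atTop X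

end OddParts

end

noncomputable section

namespace OddParts

/-! By Cauchy's formula, `Q n z` is an integral of `exp (logGen z w + n w)` over `w = η - iα`, `-π ≤
α ≤ π`, where `q = exp (-w)` and `logGen` is the logarithm of the product. Expanding the logarithms
and summing over the odd parts gives `logGen z w = ∑ z ^ j / (j * 2 sinh (j w))`. Near a root of
unity only the terms with `sinh (j w)` close to zero are large, and they add up to `A ^ 2 / w` in
the local variable `w`, where `A = amp ε g z` is an amplitude `(1/g) sqrt (Li₂ (ε z ^ g) / 2)`. Then
`A ^ 2 / w + n w` has its saddle at `w = A / √n` with value `2 A √n`, so the largest `Re A` wins.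
The phases say that this is the amplitude of `q = 1`, of `q = -1`, or of the pair `q = ±i`.

The circle is chosen through the saddle: `η = Re A / √n`. On windows of half-width `1 / √n` around
the saddles Laplace's method applies (`tendsto_window`), with the constant term of `logGen` at `q =
1` or `q = ±i` supplied by `tendsto_logGen_sub_at_one` and `tendsto_logGen_sub_at_I`.

Off the windows there is no Farey dissection. A bounded sequence of values `η * logGen` is followed
along an ultrafilter, where the integers `k` with `k α` within `O(η)` of `π ℤ` form a subgroup of
`ℤ`, and its generator `g` determines the limit (`classification`). The limit is zero or `c ^ 2 / (1
- iτ)` with an amplitude `c`, whose real part is at most `(Re c) ^ 2` (`re_sq_div`). Either `c` is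
dominated, or `τ` misses the maximiser. Hence there is a uniform gap (`exists_gap`,
`exists_offPeak_gap`), and the rest of the circle is exponentially negligible.

The case `q = -1` reduces to `q = 1` by `z ↦ -z`. For `q = ±i` the two contributions oscillate with
`n`, so they are compared with the main term by differences, using that the oscillating factor stays
away from zero when `z ≠ 0`. All limits are taken along `atTop ×ˢ 𝓝 z₀`, which yields uniformity on
compact sets. -/

/-! ### Generating function and Cauchy's formula. -/

/-- The weight of a part `i` of multiplicity `c` in a partition into odd parts. -/
def oddWeight (z : ℂ) (i c : ℕ) : ℂ := if Odd i then z ^ c else 0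

lemma coeff_genFun_oddWeight (z : ℂ) (n : ℕ) :
    PowerSeries.coeff n (Nat.Partition.genFun (oddWeight z)) = Q n z := by
  rw [Nat.Partition.coeff_genFun, Q, Nat.Partition.odds, Nat.Partition.restricted,
    Finset.sum_filter]
  refine Finset.sum_congr rfl fun p _ => ?_
  rw [Finsupp.prod]
  split_ifs with h
  · rw [← Multiset.toFinsupp_sum_eq, Finsupp.sum, ← Finset.prod_pow_eq_pow_sum]
    refine Finset.prod_congr rfl fun i hi => ?_
    have hi' : i ∈ p.parts := by simpa using hi
    simp [oddWeight, Nat.not_even_iff_odd.1 (h i hi')]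
  · push Not at h
    obtain ⟨i, hi, hi2⟩ := h
    refine Finset.prod_eq_zero (i := i) (by simpa using hi) ?_
    simp [oddWeight, Nat.not_odd_iff_even.2 hi2]

/-- The power series `F` converges absolutely at `q`, with value `v`. -/
def EvalsTo (F : PowerSeries ℂ) (q v : ℂ) : Prop :=
  Summable (fun n => ‖PowerSeries.coeff n F * q ^ n‖) ∧
    ∑' n, PowerSeries.coeff n F * q ^ n = v

lemma EvalsTo.hasSum {F : PowerSeries ℂ} {q v : ℂ} (h : EvalsTo F q v) :
    HasSum (fun n => PowerSeries.coeff n F * q ^ n) v :=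
  h.2 ▸ h.1.of_norm.hasSum

lemma evalsTo_one (q : ℂ) : EvalsTo 1 q 1 := by
  have h : ∀ n, n ∉ ({0} : Finset ℕ) →
      PowerSeries.coeff n (1 : PowerSeries ℂ) * q ^ n = 0 := by
    intro n hn
    have : n ≠ 0 := by simpa using hn
    simp [PowerSeries.coeff_one, this]
  refine ⟨summable_of_ne_finset_zero (s := {0}) fun n hn => by rw [h n hn, norm_zero], ?_⟩
  rw [tsum_eq_sum h]
  simp

lemma EvalsTo.mul {F G : PowerSeries ℂ} {q v w : ℂ} (hF : EvalsTo F q v) (hG : EvalsTo G q w) :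
    EvalsTo (F * G) q (v * w) := by
  have key : ∀ n, PowerSeries.coeff n (F * G) * q ^ n =
      ∑ kl ∈ Finset.HasAntidiagonal.antidiagonal n, (PowerSeries.coeff kl.1 F * q ^ kl.1) *
        (PowerSeries.coeff kl.2 G * q ^ kl.2) := by
    intro n
    rw [PowerSeries.coeff_mul, Finset.sum_mul]
    refine Finset.sum_congr rfl fun kl h => ?_
    rw [← Finset.HasAntidiagonal.mem_antidiagonal.1 h, pow_add]
    ring
  refine ⟨?_, ?_⟩
  · refine (summable_norm_sum_mul_antidiagonal_of_summable_norm hF.1 hG.1).congr fun n => ?_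
    rw [← key n]
  · rw [tsum_congr key, ← tsum_mul_tsum_eq_tsum_sum_antidiagonal_of_summable_norm hF.1 hG.1, hF.2, hG.2]

lemma EvalsTo.prod {F : ℕ → PowerSeries ℂ} {q : ℂ} {v : ℕ → ℂ} (h : ∀ i, EvalsTo (F i) q (v i))
    (s : Finset ℕ) : EvalsTo (∏ i ∈ s, F i) q (∏ i ∈ s, v i) := by
  induction s using Finset.cons_induction with
  | empty => simpa using evalsTo_one q
  | cons a s ha ih => rw [Finset.prod_cons, Finset.prod_cons]; exact (h a).mul ih

/-- Fourier inversion for a power series on a circle inside its disk of convergence. -/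
lemma integral_evalsTo {F : PowerSeries ℂ} {v : ℝ → ℂ} {η : ℝ}
    (h : ∀ α : ℝ, EvalsTo F (exp (-(η - α * I))) (v α)) (n : ℕ) :
    ∫ α in (-Real.pi)..Real.pi, v α * exp (n * (η - α * I)) =
      2 * Real.pi * PowerSeries.coeff n F := by
  have hnorm : ∀ α : ℝ, ∀ k : ℕ, ‖PowerSeries.coeff k F * exp (-(η - α * I)) ^ k *
      exp (n * (η - α * I))‖ =
      ‖PowerSeries.coeff k F * exp (-(η - (0 : ℝ) * I)) ^ k‖ * Real.exp (n * η) := by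
    intro α k
    simp [norm_exp]
  have hs := intervalIntegral.hasSum_integral_of_dominated_convergence
    (μ := MeasureTheory.volume) (a := -Real.pi) (b := Real.pi)
    (F := fun (k : ℕ) (α : ℝ) => PowerSeries.coeff k F * exp (-(η - α * I)) ^ k *
      exp (n * (η - α * I))) (f := fun α => v α * exp (n * (η - α * I)))
    (fun k _ => ‖PowerSeries.coeff k F * exp (-(η - (0 : ℝ) * I)) ^ k‖ * Real.exp (n * η))
    (fun k => by
      apply Continuous.aestronglyMeasurable
      fun_prop)
    (fun k => Eventually.of_forall fun α _ => (hnorm α k).le)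
    (Eventually.of_forall fun α _ => (h 0).1.mul_right _)
    (by simp)
    (Eventually.of_forall fun α _ => (h α).hasSum.mul_right _)
  refine hs.unique ?_
  have hterm : ∀ k : ℕ, ∫ α in (-Real.pi)..Real.pi, PowerSeries.coeff k F *
      exp (-(η - α * I)) ^ k * exp (n * (η - α * I)) =
      if k = n then 2 * Real.pi * PowerSeries.coeff n F else 0 := by
    intro k
    have e : ∀ α : ℝ, PowerSeries.coeff k F * exp (-(η - α * I)) ^ k * exp (n * (η - α * I)) =
        PowerSeries.coeff k F * exp ((n - k) * η) * exp ((((k : ℂ) - n) * I) * α) := by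
      intro α
      rw [← exp_nat_mul, mul_assoc, mul_assoc, ← exp_add, ← exp_add]
      congr 2
      ring
    simp_rw [e]
    rw [intervalIntegral.integral_const_mul]
    split_ifs with hk
    · subst hk
      simp
      ring
    · have hne : ((k : ℂ) - n) ≠ 0 := sub_ne_zero.2 (by exact_mod_cast hk)
      rw [integral_exp_mul_complex (mul_ne_zero hne I_ne_zero)]
      have : exp ((((k : ℂ) - n) * I) * (Real.pi : ℝ)) =
          exp ((((k : ℂ) - n) * I) * ((-Real.pi : ℝ) : ℂ)) := by
        rw [exp_eq_exp_iff_exists_int]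
        refine ⟨(k : ℤ) - n, ?_⟩
        push_cast
        ring
      rw [this]
      simp
  simp_rw [hterm]
  simpa using hasSum_ite_eq n (2 * Real.pi * PowerSeries.coeff n F)

/-- The factor of the product formula belonging to the part `i + 1`. -/
def oddFactor (z : ℂ) (i : ℕ) : PowerSeries ℂ :=
  letI := PowerSeries.WithPiTopology.instTopologicalSpace ℂ
  1 + ∑' j, oddWeight z (i + 1) (j + 1) • PowerSeries.X ^ ((i + 1) * (j + 1))

lemma coeff_oddFactor (z : ℂ) {i : ℕ} (n : ℕ) :
    PowerSeries.coeff n (oddFactor z i) = (if n = 0 then 1 else 0) +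
      ∑' j, if n = (i + 1) * (j + 1) then oddWeight z (i + 1) (j + 1) else 0 := by
  let := PowerSeries.WithPiTopology.instTopologicalSpace ℂ
  rw [oddFactor, map_add, PowerSeries.coeff_one,
    (Nat.Partition.summable_genFun_term (oddWeight z) i).map_tsum _
      (PowerSeries.WithPiTopology.continuous_coeff ℂ n)]
  simp [PowerSeries.coeff_X_pow]

lemma coeff_oddFactor_mul {z : ℂ} {i : ℕ} (hi : Odd (i + 1)) (k : ℕ) :
    PowerSeries.coeff ((i + 1) * k) (oddFactor z i) = z ^ k := by
  rw [coeff_oddFactor]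
  rcases k with _ | k
  · simp
  · rw [tsum_eq_single k]
    · simp [oddWeight, hi]
    · intro j hj
      rw [if_neg]
      intro h
      have := Nat.eq_of_mul_eq_mul_left (Nat.succ_pos i) h
      omega

lemma evalsTo_oddFactor {z q : ℂ} (hz : ‖z‖ < 1) (hq : ‖q‖ < 1) (i : ℕ) :
    EvalsTo (oddFactor z i) q (if Odd (i + 1) then (1 - z * q ^ (i + 1))⁻¹ else 1) := by
  split_ifs with hi
  · have hinj : Function.Injective (fun k : ℕ => (i + 1) * k) :=
      fun a b h => Nat.eq_of_mul_eq_mul_left (Nat.succ_pos i) h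
    have hzero : ∀ n, n ∉ Set.range (fun k : ℕ => (i + 1) * k) →
        PowerSeries.coeff n (oddFactor z i) * q ^ n = 0 := by
      intro n hn
      rw [coeff_oddFactor]
      have h0 : n ≠ 0 := fun h => hn ⟨0, by simp [h]⟩
      have h1 : ∀ j, n ≠ (i + 1) * (j + 1) := fun j h => hn ⟨j + 1, h.symm⟩
      simp [h0, h1]
    have hcomp : ∀ k, PowerSeries.coeff ((i + 1) * k) (oddFactor z i) * q ^ ((i + 1) * k) =
        (z * q ^ (i + 1)) ^ k := by
      intro k
      rw [coeff_oddFactor_mul hi, mul_pow, pow_mul]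
    have hlt : ‖z * q ^ (i + 1)‖ < 1 := by
      rw [norm_mul, norm_pow]
      exact mul_lt_one_of_nonneg_of_lt_one_left (norm_nonneg _) hz
        (pow_le_one₀ (norm_nonneg _) hq.le)
    constructor
    · refine (hinj.summable_iff fun n hn => by rw [hzero n hn, norm_zero]).1 ?_
      refine (summable_geometric_of_lt_one (norm_nonneg _) hlt).congr fun k => ?_
      simp only [Function.comp]
      rw [hcomp, norm_pow]
    · refine HasSum.tsum_eq ((hinj.hasSum_iff hzero).1 ?_)
      refine (hasSum_geometric_of_norm_lt_one hlt).congr_fun ?_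
      intro k
      simp only [Function.comp]
      rw [hcomp]
  · have : oddFactor z i = 1 := by
      ext n
      rw [coeff_oddFactor, PowerSeries.coeff_one]
      simp [oddWeight, hi]
    rw [this]
    exact evalsTo_one q

/-- The logarithm of the generating function of `Q` at `q = exp (-w)`. -/
def logGen (z w : ℂ) : ℂ := ∑' j : ℕ, z ^ (j + 1) / ((j + 1 : ℂ) * (2 * sinh ((j + 1 : ℂ) * w)))

/-- The double series underlying `logGen`. -/
def logGenTerm (z w : ℂ) (p : ℕ × ℕ) : ℂ :=
  if Odd (p.1 + 1) then (z * exp (-w) ^ (p.1 + 1)) ^ (p.2 + 1) / (p.2 + 1) else 0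

lemma norm_exp_neg_lt_one {w : ℂ} (hw : 0 < w.re) : ‖exp (-w)‖ < 1 := by
  rw [norm_exp, neg_re]
  exact Real.exp_lt_one_iff.2 (by linarith)

/-- A crude product of two geometric series, uniform in `Im w`. It serves both the interchange of
summations and the domination in Cauchy's formula. -/
lemma norm_logGenTerm_le {z w : ℂ} (hz : ‖z‖ < 1) (hw : 0 < w.re) (p : ℕ × ℕ) :
    ‖logGenTerm z w p‖ ≤ ‖exp (-w)‖ ^ p.1 * ‖z‖ ^ p.2 := by
  have hq := norm_exp_neg_lt_one hw
  rw [logGenTerm]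
  split_ifs
  · rw [norm_div, norm_pow, norm_mul, norm_pow, mul_pow]
    have h1 : (1 : ℝ) ≤ ‖(p.2 + 1 : ℂ)‖ := by
      rw [show (p.2 + 1 : ℂ) = ((p.2 + 1 : ℕ) : ℂ) by push_cast; ring, norm_natCast]
      exact_mod_cast Nat.succ_pos p.2
    refine (div_le_self (by positivity) h1).trans ?_
    rw [mul_comm, ← pow_mul]
    gcongr ?_ * ?_
    · exact pow_le_pow_of_le_one (norm_nonneg _) hq.le (by nlinarith)
    · exact pow_le_pow_of_le_one (norm_nonneg _) hz.le (by omega)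
  · simp only [norm_zero]; positivity

lemma summable_logGenTerm {z w : ℂ} (hz : ‖z‖ < 1) (hw : 0 < w.re) :
    Summable (logGenTerm z w) := by
  refine Summable.of_norm_bounded ?_ (norm_logGenTerm_le hz hw)
  exact (summable_geometric_of_lt_one (norm_nonneg _) (norm_exp_neg_lt_one hw)).mul_of_nonneg
    (summable_geometric_of_lt_one (norm_nonneg _) hz) (fun _ => by positivity)
    (fun _ => by positivity)

lemma hasSum_logGenTerm_snd {z w : ℂ} (hz : ‖z‖ < 1) (hw : 0 < w.re) (i : ℕ) :
    HasSum (fun j => logGenTerm z w (i, j))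
      (if Odd (i + 1) then -log (1 - z * exp (-w) ^ (i + 1)) else 0) := by
  unfold logGenTerm
  split_ifs
  · refine hasSum_taylorSeries_neg_log' (z := z * exp (-w) ^ (i + 1)) ?_
    rw [norm_mul, norm_pow]
    exact mul_lt_one_of_nonneg_of_lt_one_left (norm_nonneg _) hz
      (pow_le_one₀ (norm_nonneg _) (norm_exp_neg_lt_one hw).le)
  · exact hasSum_zero

/-- With `P = exp (-(j + 1) w)`, the odd powers sum to `P / (1 - P ^ 2) = 1 / (P⁻¹ - P)`, which is
where the hyperbolic sine comes from. -/
lemma hasSum_logGenTerm_fst {z w : ℂ} (hw : 0 < w.re) (j : ℕ) :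
    HasSum (fun i => logGenTerm z w (i, j))
      (z ^ (j + 1) / ((j + 1 : ℂ) * (2 * sinh ((j + 1 : ℂ) * w)))) := by
  have hinj : Function.Injective (fun m : ℕ => 2 * m) := fun a b h => by simpa using h
  refine (hinj.hasSum_iff ?_).1 ?_
  · intro i hi
    rw [logGenTerm, if_neg]
    rintro ⟨m, hm⟩
    exact hi ⟨m, by simp only; omega⟩
  · set P := exp (-((j + 1 : ℂ) * w)) with hP
    have hPn : ‖P‖ < 1 := by
      apply norm_exp_neg_lt_one
      have : ((j + 1 : ℂ) * w).re = (j + 1) * w.re := by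
        rw [show (j + 1 : ℂ) = ((j + 1 : ℝ) : ℂ) by push_cast; ring, re_ofReal_mul]
      rw [this]; positivity
    have hP0 : P ≠ 0 := exp_ne_zero _
    have hP2 : ‖P ^ 2‖ < 1 := by
      rw [norm_pow]; exact pow_lt_one₀ (norm_nonneg _) hPn two_ne_zero
    have hP1 : 1 - P ^ 2 ≠ 0 := by
      intro h
      rw [← sub_eq_zero.1 h] at hP2
      simp at hP2
    have hg := (hasSum_geometric_of_norm_lt_one hP2).mul_left (z ^ (j + 1) / (j + 1) * P)
    have hq : exp (-w) ^ (j + 1) = P := by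
      rw [← exp_nat_mul, hP]; congr 1; push_cast; ring
    have hval : z ^ (j + 1) / ((j + 1 : ℂ) * (2 * sinh ((j + 1 : ℂ) * w))) =
        z ^ (j + 1) / (j + 1) * P * (1 - P ^ 2)⁻¹ := by
      have hs : 2 * sinh ((j + 1 : ℂ) * w) = P⁻¹ - P := by
        rw [sinh, hP, ← exp_neg, neg_neg]; ring
      have hj : (j + 1 : ℂ) ≠ 0 := by exact_mod_cast Nat.succ_ne_zero j
      have : P⁻¹ - P = (1 - P ^ 2) / P := by field_simp
      rw [hs, this]
      field_simp
    rw [hval]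
    refine hg.congr_fun fun m => ?_
    simp only [Function.comp, logGenTerm]
    rw [if_pos ⟨m, rfl⟩, ← hq]
    ring

/-- The absolutely convergent double series is summed in both orders: by parts it is the logarithm
of the product, by powers of `z` it is `logGen`. -/
lemma hasSum_logGen {z w : ℂ} (hz : ‖z‖ < 1) (hw : 0 < w.re) :
    HasSum (fun i => if Odd (i + 1) then -log (1 - z * exp (-w) ^ (i + 1)) else 0)
      (logGen z w) := by
  have h1 := (summable_logGenTerm hz hw).hasSum.prod_fiberwise (hasSum_logGenTerm_snd hz hw)
  have h2 := ((Equiv.prodComm ℕ ℕ).hasSum_iff.2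
    (summable_logGenTerm hz hw).hasSum).prod_fiberwise (hasSum_logGenTerm_fst hw)
  rw [logGen, h2.tsum_eq]
  exact h1

lemma prod_eq_exp {z w : ℂ} (hz : ‖z‖ < 1) (hw : 0 < w.re) (s : Finset ℕ) :
    ∏ i ∈ s, (if Odd (i + 1) then (1 - z * exp (-w) ^ (i + 1))⁻¹ else 1) =
      exp (∑ i ∈ s, if Odd (i + 1) then -log (1 - z * exp (-w) ^ (i + 1)) else 0) := by
  rw [exp_sum]
  refine Finset.prod_congr rfl fun i _ => ?_
  split_ifs
  · rw [Complex.exp_neg (log _), exp_log]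
    intro h
    have : ‖z * exp (-w) ^ (i + 1)‖ < 1 := by
      rw [norm_mul, norm_pow]
      exact mul_lt_one_of_nonneg_of_lt_one_left (norm_nonneg _) hz
        (pow_le_one₀ (norm_nonneg _) (norm_exp_neg_lt_one hw).le)
    rw [← sub_eq_zero.1 h] at this
    simp at this
  · simp

/-- Cauchy's formula for the coefficients of the generating function of `Q`. -/
theorem integral_exp_logGen {z : ℂ} (hz : ‖z‖ < 1) {η : ℝ} (hη : 0 < η) (n : ℕ) :
    ∫ α in (-Real.pi)..Real.pi, exp (logGen z (η - α * I)) * exp (n * (η - α * I)) =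
      2 * Real.pi * Q n z := by
  let := PowerSeries.WithPiTopology.instTopologicalSpace ℂ
  have hre : ∀ α : ℝ, 0 < ((η : ℂ) - α * I).re := fun α => by simpa using hη
  have hnq : ∀ α : ℝ, ‖exp (-((η : ℂ) - α * I))‖ = Real.exp (-η) := fun α => by simp [norm_exp]
  -- Fourier inversion is used for finite products only. The coefficients then converge by
  -- convergence of the formal product, and the integrals by dominated convergence.
  have hcoef : Tendsto (fun s : Finset ℕ => 2 * Real.pi *
      PowerSeries.coeff n (∏ i ∈ s, oddFactor z i)) atTop (𝓝 (2 * Real.pi * Q n z)) := by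
    rw [← coeff_genFun_oddWeight]
    refine Tendsto.const_mul _ ?_
    have h := Nat.Partition.hasProd_genFun (oddWeight z)
    rw [HasProd, PowerSeries.WithPiTopology.tendsto_iff_coeff_tendsto] at h
    exact h n
  refine tendsto_nhds_unique ?_ hcoef
  have hint : ∀ s : Finset ℕ, 2 * Real.pi * PowerSeries.coeff n (∏ i ∈ s, oddFactor z i) =
      ∫ α in (-Real.pi)..Real.pi, exp (∑ i ∈ s, if Odd (i + 1) then
        -log (1 - z * exp (-((η : ℂ) - α * I)) ^ (i + 1)) else 0) * exp (n * (η - α * I)) := by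
    intro s
    refine (integral_evalsTo (fun α => ?_) n).symm
    rw [← prod_eq_exp hz (hre α)]
    exact EvalsTo.prod (fun i => evalsTo_oddFactor hz (norm_exp_neg_lt_one (hre α)) i) s
  simp_rw [hint]
  have hT : ∀ α : ℝ, ∀ i : ℕ, ‖(if Odd (i + 1) then
      -log (1 - z * exp (-((η : ℂ) - α * I)) ^ (i + 1)) else 0)‖ ≤
      Real.exp (-η) ^ i * (1 - ‖z‖)⁻¹ := by
    intro α i
    have h1 := (hasSum_geometric_of_lt_one (norm_nonneg _) hz).mul_left (Real.exp (-η) ^ i)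
    rw [← (hasSum_logGenTerm_snd hz (hre α) i).tsum_eq]
    refine tsum_of_norm_bounded h1 fun j => ?_
    rw [← hnq α]
    exact norm_logGenTerm_le hz (hre α) (i, j)
  have hsum : Summable (fun i : ℕ => Real.exp (-η) ^ i * (1 - ‖z‖)⁻¹) :=
    (summable_geometric_of_lt_one (Real.exp_pos _).le
      (Real.exp_lt_one_iff.2 (by linarith))).mul_right _
  refine intervalIntegral.tendsto_integral_filter_of_dominated_convergence
    (fun _ => Real.exp (∑' i : ℕ, Real.exp (-η) ^ i * (1 - ‖z‖)⁻¹) * Real.exp (n * η)) ?_ ?_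
    (by simp) ?_
  · refine Eventually.of_forall fun s => Measurable.aestronglyMeasurable ?_
    refine Measurable.mul (Measurable.cexp (Finset.measurable_fun_sum _ fun i _ => ?_))
      (by fun_prop)
    split_ifs
    · fun_prop
    · fun_prop
  · refine Eventually.of_forall fun s => Eventually.of_forall fun α _ => ?_
    rw [norm_mul]
    refine mul_le_mul ?_ ?_ (norm_nonneg _) (Real.exp_pos _).le
    · refine (norm_exp_le_exp_norm _).trans (Real.exp_le_exp.2 ?_)
      refine (norm_sum_le_of_le _ fun i _ => hT α i).trans ?_
      exact hsum.sum_le_tsum _ fun i _ => (norm_nonneg _).trans (hT 0 i)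
    · simp [norm_exp]
  · refine Eventually.of_forall fun α _ => ?_
    exact ((continuous_exp.tendsto _).comp (hasSum_logGen hz (hre α))).mul_const _

/-! ### Hyperbolic functions in sectors. -/

lemma re_le_norm_sinh {x : ℂ} (hx : 0 ≤ x.re) : x.re ≤ ‖sinh x‖ := by
  have h := norm_sub_norm_le (exp x) (exp (-x))
  rw [norm_exp, norm_exp, neg_re] at h
  have h2 : ‖sinh x‖ = ‖exp x - exp (-x)‖ / 2 := by rw [sinh, norm_div]; simp
  have h3 := Real.self_le_sinh_iff.2 hx
  rw [Real.sinh_eq] at h3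
  linarith

lemma re_le_norm_cosh {x : ℂ} (hx : 0 ≤ x.re) : x.re ≤ ‖cosh x‖ := by
  have h := norm_sub_le_norm_add (exp x) (exp (-x))
  rw [norm_exp, norm_exp, neg_re] at h
  have h2 : ‖cosh x‖ = ‖exp x + exp (-x)‖ / 2 := by rw [cosh, norm_div]; simp
  have h3 := Real.self_le_sinh_iff.2 hx
  rw [Real.sinh_eq] at h3
  linarith

/-- Unlike the bound by the real part, this detects the distance of `Im x` from `π ℤ`; it kills the
nonresonant terms. -/
lemma abs_sin_im_le_norm_sinh (x : ℂ) : |Real.sin x.im| ≤ ‖sinh x‖ := by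
  have him : (sinh x).im = Real.cosh x.re * Real.sin x.im := by
    rw [← re_add_im x, sinh_add, cosh_mul_I, sinh_mul_I]
    simp [← ofReal_sinh, ← ofReal_cosh, ← ofReal_sin, ← ofReal_cos]
  refine le_trans ?_ (abs_im_le_norm _)
  rw [him, abs_mul, abs_of_pos (Real.cosh_pos _)]
  exact le_mul_of_one_le_left (abs_nonneg _) (Real.one_le_cosh _)

/-- A sector in the right half plane. -/
def sector (K : ℝ) : Set ℂ := {w | 0 < w.re ∧ |w.im| ≤ K * w.re}

lemma norm_le_of_mem_sector {K : ℝ} {w : ℂ} (hw : w ∈ sector K) : ‖w‖ ≤ (K + 1) * w.re := by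
  have h1 := norm_le_abs_re_add_abs_im w
  rw [abs_of_pos hw.1] at h1
  linarith [hw.2]

lemma natCast_succ_mul_re (j : ℕ) (w : ℂ) : ((j + 1 : ℂ) * w).re = (j + 1) * w.re := by
  rw [show (j + 1 : ℂ) = ((j + 1 : ℝ) : ℂ) by push_cast; ring, re_ofReal_mul]

lemma natCast_succ_mul_im (j : ℕ) (w : ℂ) : ((j + 1 : ℂ) * w).im = (j + 1) * w.im := by
  rw [show (j + 1 : ℂ) = ((j + 1 : ℝ) : ℂ) by push_cast; ring, im_ofReal_mul]

lemma norm_natCast_succ (j : ℕ) : ‖(j + 1 : ℂ)‖ = j + 1 := by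
  rw [show (j + 1 : ℂ) = ((j + 1 : ℕ) : ℂ) by push_cast; ring, norm_natCast]
  push_cast; ring

lemma natCast_succ_ne_zero (j : ℕ) : (j + 1 : ℂ) ≠ 0 := by exact_mod_cast Nat.succ_ne_zero j

lemma mul_mem_sector {K : ℝ} {w : ℂ} (hw : w ∈ sector K) (j : ℕ) :
    (j + 1 : ℂ) * w ∈ sector K := by
  constructor
  · rw [natCast_succ_mul_re]; have := hw.1; positivity
  · rw [natCast_succ_mul_re, natCast_succ_mul_im, abs_mul,
      abs_of_nonneg (by positivity : (0 : ℝ) ≤ j + 1)]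
    have := mul_le_mul_of_nonneg_left hw.2 (by positivity : (0 : ℝ) ≤ j + 1)
    linarith

lemma sinh_ne_zero_of_re_pos {x : ℂ} (hx : 0 < x.re) : sinh x ≠ 0 :=
  norm_pos_iff.1 (hx.trans_le (re_le_norm_sinh hx.le))

lemma norm_sinh_sub_self_le {x : ℂ} (hx : ‖x‖ ≤ 1) : ‖sinh x - x‖ ≤ ‖x‖ ^ 3 := by
  have h1 := exp_bound hx (n := 3) (by norm_num)
  have h2 := exp_bound (x := -x) (by rwa [norm_neg]) (n := 3) (by norm_num)
  rw [norm_neg] at h2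
  have e : sinh x - x = ((exp x - ∑ m ∈ Finset.range 3, x ^ m / (m.factorial : ℂ)) -
      (exp (-x) - ∑ m ∈ Finset.range 3, (-x) ^ m / (m.factorial : ℂ))) / 2 := by
    simp [Finset.sum_range_succ, sinh]; ring
  have h3 := norm_sub_le (exp x - ∑ m ∈ Finset.range 3, x ^ m / (m.factorial : ℂ))
    (exp (-x) - ∑ m ∈ Finset.range 3, (-x) ^ m / (m.factorial : ℂ))
  rw [e, norm_div]
  have hf : ((Nat.succ 3 : ℕ) : ℝ) * (((Nat.factorial 3 : ℕ) : ℝ) * ((3 : ℕ) : ℝ))⁻¹ ≤ 1 := by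
    norm_num [Nat.factorial]
  have h4 := mul_le_mul_of_nonneg_left hf (pow_nonneg (norm_nonneg x) 3)
  have : ‖(2 : ℂ)‖ = 2 := by simp
  rw [this]
  linarith

lemma norm_cosh_sub_one_le {x : ℂ} (hx : ‖x‖ ≤ 1) : ‖cosh x - 1‖ ≤ ‖x‖ ^ 2 := by
  have h1 := exp_bound hx (n := 2) (by norm_num)
  have h2 := exp_bound (x := -x) (by rwa [norm_neg]) (n := 2) (by norm_num)
  rw [norm_neg] at h2
  have e : cosh x - 1 = ((exp x - ∑ m ∈ Finset.range 2, x ^ m / (m.factorial : ℂ)) +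
      (exp (-x) - ∑ m ∈ Finset.range 2, (-x) ^ m / (m.factorial : ℂ))) / 2 := by
    simp [Finset.sum_range_succ, cosh]; ring
  have h3 := norm_add_le (exp x - ∑ m ∈ Finset.range 2, x ^ m / (m.factorial : ℂ))
    (exp (-x) - ∑ m ∈ Finset.range 2, (-x) ^ m / (m.factorial : ℂ))
  rw [e, norm_div]
  have hf : ((Nat.succ 2 : ℕ) : ℝ) * (((Nat.factorial 2 : ℕ) : ℝ) * ((2 : ℕ) : ℝ))⁻¹ ≤ 1 := by
    norm_num [Nat.factorial]
  have h4 := mul_le_mul_of_nonneg_left hf (pow_nonneg (norm_nonneg x) 2)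
  have : ‖(2 : ℂ)‖ = 2 := by simp
  rw [this]
  linarith

/-- In a sector `‖x‖ ≤ (K + 1) Re x ≤ (K + 1) ‖sinh x‖`, so dividing the cubic error of `sinh x - x`
by `x sinh x` still leaves one power of `x`. -/
lemma norm_inv_sinh_sub_inv_le {K : ℝ} {x : ℂ} (hx : x ∈ sector K)
    (h1 : ‖x‖ ≤ 1) : ‖(sinh x)⁻¹ - x⁻¹‖ ≤ (K + 1) * ‖x‖ := by
  have hx0 : x ≠ 0 := fun h => by simpa [h] using hx.1
  have hxp : 0 < ‖x‖ := norm_pos_iff.2 hx0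
  have hs := sinh_ne_zero_of_re_pos hx.1
  have e : (sinh x)⁻¹ - x⁻¹ = -(sinh x - x) / (sinh x * x) := by field_simp; ring
  rw [e, norm_div, norm_neg, norm_mul, div_le_iff₀ (mul_pos (norm_pos_iff.2 hs) hxp)]
  have h2 := norm_sinh_sub_self_le h1
  have h3 : ‖x‖ ≤ (K + 1) * ‖sinh x‖ :=
    (norm_le_of_mem_sector hx).trans (mul_le_mul_of_nonneg_left (re_le_norm_sinh hx.1.le) (by
      have := (hxp.trans_le (norm_le_of_mem_sector hx))
      exact (pos_of_mul_pos_left this hx.1.le).le))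
  calc ‖sinh x - x‖ ≤ ‖x‖ ^ 3 := h2
    _ = ‖x‖ * (‖x‖ * ‖x‖) := by ring
    _ ≤ ((K + 1) * ‖sinh x‖) * (‖x‖ * ‖x‖) := by gcongr
    _ = _ := by ring

/-- Valid on the whole unbounded sector: for small `w` the points `(j + 1) w` leave every disk as
`j` grows, and domination must be uniform in `j`. -/
lemma norm_inv_sinh_sub_inv_le' {K : ℝ} (hK : 0 ≤ K) {x : ℂ} (hx : x ∈ sector K) :
    ‖(sinh x)⁻¹ - x⁻¹‖ ≤ 2 * (K + 1) := by
  rcases le_total ‖x‖ 1 with h | h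
  · refine (norm_inv_sinh_sub_inv_le hx h).trans ?_
    nlinarith [norm_nonneg x]
  · have hr : 1 ≤ (K + 1) * x.re := h.trans (norm_le_of_mem_sector hx)
    have h1 : ‖(sinh x)⁻¹‖ ≤ K + 1 := by
      rw [norm_inv]
      refine inv_le_of_inv_le₀ (by positivity) ?_
      refine le_trans ?_ (re_le_norm_sinh hx.1.le)
      rw [inv_le_iff_one_le_mul₀ (by positivity)]
      linarith
    have h2 : ‖x⁻¹‖ ≤ 1 := by rw [norm_inv]; exact inv_le_one_of_one_le₀ h
    refine (norm_sub_le _ _).trans ?_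
    linarith

lemma norm_inv_cosh_le {K : ℝ} (hK : 0 ≤ K) {x : ℂ} (hx : x ∈ sector K) :
    ‖(cosh x)⁻¹‖ ≤ 2 * (K + 1) := by
  rw [norm_inv]
  refine inv_le_of_inv_le₀ (by positivity) ?_
  rw [inv_le_iff_one_le_mul₀ (by positivity)]
  rcases le_total ‖x‖ (1 / 2) with h | h
  · have h1 := norm_cosh_sub_one_le (h.trans (by norm_num))
    have h2 := norm_sub_norm_le (1 : ℂ) (1 - cosh x)
    rw [norm_sub_rev 1 (cosh x), sub_sub_cancel, norm_one] at h2
    have h3 : ‖x‖ ^ 2 ≤ 1 / 4 := by nlinarith [norm_nonneg x]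
    nlinarith
  · have hr : 1 / 2 ≤ (K + 1) * x.re := h.trans (norm_le_of_mem_sector hx)
    have := mul_le_mul_of_nonneg_left (re_le_norm_cosh hx.1.le) (by linarith : 0 ≤ K + 1)
    linarith

/-- Small points of a sector. -/
def sectorNhds (K : ℝ) : Filter ℂ := 𝓝 0 ⊓ 𝓟 (sector K)

lemma eventually_mem_sector (K : ℝ) : ∀ᶠ w in sectorNhds K, w ∈ sector K :=
  mem_inf_of_right (mem_principal_self _)

lemma tendsto_sectorNhds (K : ℝ) : Tendsto id (sectorNhds K) (𝓝 0) := inf_le_left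

lemma tendsto_inv_sinh_sub_inv {K : ℝ} (j : ℕ) :
    Tendsto (fun w : ℂ => (sinh ((j + 1 : ℂ) * w))⁻¹ - ((j + 1 : ℂ) * w)⁻¹)
      (sectorNhds K) (𝓝 0) := by
  have h0 : Tendsto (fun w : ℂ => (j + 1 : ℂ) * w) (sectorNhds K) (𝓝 0) := by
    simpa using (tendsto_sectorNhds K).const_mul (j + 1 : ℂ)
  have h1 : Tendsto (fun w : ℂ => (K + 1) * ‖(j + 1 : ℂ) * w‖) (sectorNhds K) (𝓝 0) := by
    simpa using h0.norm.const_mul (K + 1)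
  refine squeeze_zero_norm' ?_ h1
  have h2 : ∀ᶠ w in sectorNhds K, ‖(j + 1 : ℂ) * w‖ < 1 :=
    h0.norm.eventually_lt_const (by simp)
  filter_upwards [h2, eventually_mem_sector K] with w hw hs
  exact norm_inv_sinh_sub_inv_le (mul_mem_sector hs j) hw.le

/-! ### The generating function near `q = 1` and `q = ±i`. -/

/-- Dominated convergence for the logarithmic series with a bounded kernel. -/
lemma tendsto_tsum_kernel {ι : Type*} {l : Filter ι} {k : ℕ → ι → ℂ} {c : ℕ → ℂ} {C : ℝ}
    {z₀ : ℂ} (hz : ‖z₀‖ < 1) {z : ι → ℂ} (hzt : Tendsto z l (𝓝 z₀))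
    (hk : ∀ j, Tendsto (k j) l (𝓝 (c j))) (hC : ∀ᶠ i in l, ∀ j, ‖k j i‖ ≤ C) :
    Tendsto (fun i => ∑' j : ℕ, z i ^ (j + 1) / (j + 1) * k j i) l
      (𝓝 (∑' j : ℕ, z₀ ^ (j + 1) / (j + 1) * c j)) := by
  obtain ⟨r, hr1, hr2⟩ := exists_between hz
  have hr0 : 0 ≤ r := (norm_nonneg _).trans hr1.le
  refine tendsto_tsum_of_dominated_convergence (bound := fun j => r ^ j * C)
    ((summable_geometric_of_lt_one hr0 hr2).mul_right _) ?_ ?_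
  · intro j
    exact ((hzt.pow _).div_const _).mul (hk j)
  · filter_upwards [hzt.norm.eventually_lt_const hr1, hC] with i h1 h2 j
    rw [norm_mul, norm_div, norm_pow, norm_natCast_succ]
    refine mul_le_mul ?_ (h2 j) (norm_nonneg _) (by positivity)
    refine (div_le_self (by positivity) (by linarith [(Nat.cast_nonneg j : (0 : ℝ) ≤ j)])).trans ?_
    calc ‖z i‖ ^ (j + 1) ≤ r ^ (j + 1) := by gcongr
      _ ≤ r ^ j := pow_le_pow_of_le_one hr0 hr2.le (Nat.le_succ j)

lemma summable_mul_kernel {z : ℂ} (hz : ‖z‖ < 1) {k : ℕ → ℂ} {C : ℝ} (hC : ∀ j, ‖k j‖ ≤ C) :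
    Summable (fun j : ℕ => z ^ (j + 1) / (j + 1) * k j) := by
  refine Summable.of_norm_bounded (g := fun j => ‖z‖ ^ j * C)
    ((summable_geometric_of_lt_one (norm_nonneg _) hz).mul_right _) fun j => ?_
  rw [norm_mul, norm_div, norm_pow, norm_natCast_succ]
  refine mul_le_mul ?_ (hC j) (norm_nonneg _) (by positivity)
  refine (div_le_self (by positivity) (by linarith [(Nat.cast_nonneg j : (0 : ℝ) ≤ j)])).trans ?_
  exact pow_le_pow_of_le_one (norm_nonneg _) hz.le (Nat.le_succ j)

lemma norm_inv_two_sinh_le {w : ℂ} (hw : 0 < w.re) (j : ℕ) :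
    ‖(2 * sinh ((j + 1 : ℂ) * w))⁻¹‖ ≤ w.re⁻¹ := by
  have h1 := re_le_norm_sinh (x := (j + 1 : ℂ) * w) (by rw [natCast_succ_mul_re]; positivity)
  rw [natCast_succ_mul_re] at h1
  rw [norm_inv, norm_mul]
  apply inv_anti₀ hw
  have : ‖(2 : ℂ)‖ = 2 := by simp
  rw [this]
  nlinarith [(Nat.cast_nonneg j : (0 : ℝ) ≤ j)]

lemma logGen_eq_tsum_kernel (z w : ℂ) :
    logGen z w = ∑' j : ℕ, z ^ (j + 1) / (j + 1) * (2 * sinh ((j + 1 : ℂ) * w))⁻¹ := by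
  rw [logGen]
  refine tsum_congr fun j => ?_
  rw [← div_div, div_eq_mul_inv _ (2 * _)]

lemma summable_logGen {z w : ℂ} (hz : ‖z‖ < 1) (hw : 0 < w.re) :
    Summable (fun j : ℕ => z ^ (j + 1) / (j + 1) * (2 * sinh ((j + 1 : ℂ) * w))⁻¹) :=
  summable_mul_kernel hz fun j => norm_inv_two_sinh_le hw j

lemma Li₂_eq_tsum_kernel (z : ℂ) :
    Li₂ z = ∑' j : ℕ, z ^ (j + 1) / (j + 1) * (j + 1 : ℂ)⁻¹ := by
  rw [Li₂]
  refine tsum_congr fun j => ?_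
  rw [sq, ← div_div, div_eq_mul_inv _ (j + 1 : ℂ)]

lemma norm_inv_natCast_succ_le (j : ℕ) : ‖(j + 1 : ℂ)⁻¹‖ ≤ 1 := by
  rw [norm_inv, norm_natCast_succ]
  exact inv_le_one_of_one_le₀ (by linarith [(Nat.cast_nonneg j : (0 : ℝ) ≤ j)])

lemma summable_Li₂ {z : ℂ} (hz : ‖z‖ < 1) :
    Summable (fun j : ℕ => z ^ (j + 1) / (j + 1) * (j + 1 : ℂ)⁻¹) :=
  summable_mul_kernel hz norm_inv_natCast_succ_le

lemma continuousAt_Li₂ {z₀ : ℂ} (hz : ‖z₀‖ < 1) : ContinuousAt Li₂ z₀ := by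
  have := tendsto_tsum_kernel hz (tendsto_id (x := 𝓝 z₀))
    (k := fun j _ => (j + 1 : ℂ)⁻¹) (C := 1)
    (fun j => tendsto_const_nhds) (Eventually.of_forall fun _ => norm_inv_natCast_succ_le)
  simp_rw [← Li₂_eq_tsum_kernel] at this
  exact this

lemma eventually_norm_lt_one {z₀ : ℂ} (hz : ‖z₀‖ < 1) {l : Filter ℂ} :
    ∀ᶠ p : ℂ × ℂ in 𝓝 z₀ ×ˢ l, ‖p.1‖ < 1 :=
  (tendsto_fst.norm.eventually_lt_const hz : ∀ᶠ p : ℂ × ℂ in 𝓝 z₀ ×ˢ l, ‖p.1‖ < 1)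

/-- Behaviour of the generating function near `q = 1`. -/
lemma tendsto_logGen_sub_at_one {z₀ : ℂ} (hz : ‖z₀‖ < 1) {K : ℝ} (hK : 0 ≤ K) :
    Tendsto (fun p : ℂ × ℂ => logGen p.1 p.2 - 1 / 2 * Li₂ p.1 / p.2)
      (𝓝 z₀ ×ˢ sectorNhds K) (𝓝 0) := by
  have h := tendsto_tsum_kernel (l := 𝓝 z₀ ×ˢ sectorNhds K) hz tendsto_fst
    (k := fun j p => ((sinh ((j + 1 : ℂ) * p.2))⁻¹ - ((j + 1 : ℂ) * p.2)⁻¹) / 2)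
    (c := fun _ => 0 / 2) (C := 2 * (K + 1))
    (fun j => ((tendsto_inv_sinh_sub_inv j).comp tendsto_snd).div_const 2)
    (by
      filter_upwards [tendsto_snd.eventually (eventually_mem_sector K)] with p hp j
      rw [norm_div]
      have := norm_inv_sinh_sub_inv_le' hK (mul_mem_sector hp j)
      refine (div_le_self (norm_nonneg _) (by simp)).trans this)
  simp only [zero_div, mul_zero, tsum_zero] at h
  refine h.congr' ?_
  filter_upwards [tendsto_snd.eventually (eventually_mem_sector K), eventually_norm_lt_one hz]
    with p hp hz1
  rw [logGen_eq_tsum_kernel, Li₂_eq_tsum_kernel, mul_div_right_comm, ← tsum_mul_left,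
    ← (summable_logGen hz1 hp.1).tsum_sub ((summable_Li₂ hz1).mul_left _)]
  refine tsum_congr fun j => ?_
  rw [mul_inv, mul_inv]
  ring

/-- Since `exp (u π / 2) = u` and `u ^ 2 = -1`, the shift turns `sinh` into `cosh` for odd `j`. Thus
even `j` carry the pole at `w = 0`, and odd `j` have a finite limit and produce the constant term.
-/
lemma inv_two_sinh_shift {u : ℂ} (hu : u = I ∨ u = -I) (w : ℂ) (j : ℕ) :
    (2 * sinh ((j : ℂ) * (w - u * (Real.pi / 2))))⁻¹ =
      u ^ j * (if Even j then (2 * sinh (j * w))⁻¹ else (2 * cosh (j * w))⁻¹) := by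
  have hu2 : u ^ 2 = -1 := by rcases hu with rfl | rfl <;> simp
  have hu0 : u ≠ 0 := fun h => by simp [h] at hu2
  have hexp : exp (u * (Real.pi / 2)) = u := by
    rcases hu with rfl | rfl
    · rw [mul_comm, exp_pi_div_two_mul_I]
    · rw [neg_mul, Complex.exp_neg, mul_comm, exp_pi_div_two_mul_I, inv_I]
  have e1 : exp ((j : ℂ) * (w - u * (Real.pi / 2))) = exp (j * w) / u ^ j := by
    rw [mul_sub, exp_sub, exp_nat_mul (u * _), hexp]
  have e2 : exp (-((j : ℂ) * (w - u * (Real.pi / 2)))) = exp (-(j * w)) * u ^ j := by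
    rw [mul_sub, neg_sub, sub_eq_neg_add, exp_add, exp_nat_mul (u * _), hexp]
  have key : u ^ j * (2 * sinh ((j : ℂ) * (w - u * (Real.pi / 2)))) =
      exp (j * w) - (-1) ^ j * exp (-(j * w)) := by
    rw [sinh, e1, e2, ← hu2, ← pow_mul, mul_comm 2 j, pow_mul]
    field_simp
  have h3 : (2 * sinh ((j : ℂ) * (w - u * (Real.pi / 2))))⁻¹ =
      u ^ j * (u ^ j * (2 * sinh ((j : ℂ) * (w - u * (Real.pi / 2)))))⁻¹ := by
    rw [mul_inv (u ^ j), mul_inv_cancel_left₀ (pow_ne_zero _ hu0)]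
  rw [h3, key]
  split_ifs with h
  · rw [h.neg_one_pow, sinh]; congr 2; ring
  · rw [(Nat.not_even_iff_odd.1 h).neg_one_pow, cosh]; congr 2; ring

/-- The sum of the odd part of the logarithmic series. -/
lemma tsum_odd_log {x : ℂ} (hx : ‖x‖ < 1) :
    ∑' j : ℕ, (if Even (j + 1) then 0 else x ^ (j + 1) / (j + 1) / 2) =
      (log (1 + x) - log (1 - x)) / 4 := by
  have h1 := hasSum_taylorSeries_neg_log' hx
  have h2 := hasSum_taylorSeries_neg_log' (z := -x) (by rwa [norm_neg])
  have h3 := (h1.sub h2).div_const 4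
  rw [sub_neg_eq_add 1 x] at h3
  have e : (log (1 + x) - log (1 - x)) / 4 = (-log (1 - x) - -log (1 + x)) / 4 := by ring
  rw [e, ← h3.tsum_eq]
  refine tsum_congr fun j => ?_
  split_ifs with h
  · rw [h.neg_pow]; ring
  · rw [(Nat.not_even_iff_odd.1 h).neg_pow]; ring

lemma tsum_even_Li₂ (u z : ℂ) :
    ∑' j : ℕ, (if Even (j + 1) then (u * z) ^ (j + 1) / (j + 1) * (j + 1 : ℂ)⁻¹ else 0) =
      1 / 4 * Li₂ (u ^ 2 * z ^ 2) := by
  rw [Li₂, ← tsum_mul_left]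
  have hinj : Function.Injective (fun m : ℕ => 2 * m + 1) := fun a b h => by simpa using h
  rw [← hinj.tsum_eq]
  · refine tsum_congr fun m => ?_
    have he : Even (2 * m + 1 + 1) := ⟨m + 1, by ring⟩
    have h0 := natCast_succ_ne_zero m
    rw [if_pos he, ← mul_pow, ← pow_mul, show 2 * (m + 1) = 2 * m + 1 + 1 by ring]
    push_cast
    rw [show (2 * (m : ℂ) + 1 + 1) = 2 * (m + 1) by ring]
    field_simp
    ring
  · intro j hj
    have : Even (j + 1) := by
      by_contra h
      simp [h] at hj
    obtain ⟨m, hm⟩ := this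
    exact ⟨m - 1, by simp only; omega⟩

/-- Behaviour of the generating function near `q = ±i`. -/
lemma tendsto_logGen_sub_at_I {u : ℂ} (hu : u = I ∨ u = -I) {z₀ : ℂ} (hz : ‖z₀‖ < 1) {K : ℝ}
    (hK : 0 ≤ K) :
    Tendsto (fun p : ℂ × ℂ => logGen p.1 (p.2 - u * (Real.pi / 2)) -
        1 / 8 * Li₂ (-p.1 ^ 2) / p.2)
      (𝓝 z₀ ×ˢ sectorNhds K) (𝓝 ((log (1 + u * z₀) - log (1 - u * z₀)) / 4)) := by
  have hu2 : u ^ 2 = -1 := by rcases hu with rfl | rfl <;> simp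
  have hun : ‖u‖ = 1 := by rcases hu with rfl | rfl <;> simp
  have hure : u.re = 0 := by rcases hu with rfl | rfl <;> simp
  have h := tendsto_tsum_kernel (l := 𝓝 z₀ ×ˢ sectorNhds K) hz tendsto_fst
    (k := fun j p => if Even (j + 1) then
      u ^ (j + 1) * ((sinh ((j + 1 : ℂ) * p.2))⁻¹ - ((j + 1 : ℂ) * p.2)⁻¹) / 2 else
      u ^ (j + 1) * (cosh ((j + 1 : ℂ) * p.2))⁻¹ / 2)
    -- After the pole is removed, even indices tend to zero and odd ones to `u ^ (j + 1) / 2`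
    -- because `cosh 0 = 1`.
    (c := fun j => if Even (j + 1) then 0 else u ^ (j + 1) / 2) (C := 2 * (K + 1))
    (fun j => by
      split_ifs
      · simpa using (((tendsto_inv_sinh_sub_inv j).comp tendsto_snd).const_mul
          (u ^ (j + 1))).div_const 2
      · have hc : Tendsto (fun w : ℂ => (cosh ((j + 1 : ℂ) * w))⁻¹) (sectorNhds K) (𝓝 1) := by
          have h1 : ContinuousAt (fun w : ℂ => (cosh ((j + 1 : ℂ) * w))⁻¹) 0 := by
            apply ContinuousAt.inv₀
            · exact (continuous_cosh.comp (continuous_const.mul continuous_id)).continuousAt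
            · simp
          have h2 := h1.tendsto.comp (tendsto_sectorNhds K)
          simpa using h2
        simpa using ((hc.comp tendsto_snd).const_mul (u ^ (j + 1))).div_const 2)
    (by
      filter_upwards [tendsto_snd.eventually (eventually_mem_sector K)] with p hp j
      split_ifs
      · rw [norm_div, norm_mul, norm_pow, hun, one_pow, one_mul]
        exact (div_le_self (norm_nonneg _) (by simp)).trans
          (norm_inv_sinh_sub_inv_le' hK (mul_mem_sector hp j))
      · rw [norm_div, norm_mul, norm_pow, hun, one_pow, one_mul]
        exact (div_le_self (norm_nonneg _) (by simp)).trans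
          (norm_inv_cosh_le hK (mul_mem_sector hp j)))
  have hlim : ∑' j : ℕ, z₀ ^ (j + 1) / (j + 1) * (if Even (j + 1) then 0 else u ^ (j + 1) / 2) =
      (log (1 + u * z₀) - log (1 - u * z₀)) / 4 := by
    rw [← tsum_odd_log (by rw [norm_mul, hun, one_mul]; exact hz)]
    refine tsum_congr fun j => ?_
    split_ifs
    · simp
    · rw [mul_pow]; ring
  rw [hlim] at h
  refine h.congr' ?_
  filter_upwards [tendsto_snd.eventually (eventually_mem_sector K), eventually_norm_lt_one hz]
    with p hp hz1
  have hre : 0 < (p.2 - u * (Real.pi / 2)).re := by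
    have : (u * ((Real.pi : ℂ) / 2)).re = 0 := by
      rw [show ((Real.pi : ℂ) / 2) = ((Real.pi / 2 : ℝ) : ℂ) by push_cast; ring, re_mul_ofReal,
        hure, zero_mul]
    rw [sub_re, this, sub_zero]
    exact hp.1
  have hLi : 1 / 8 * Li₂ (-p.1 ^ 2) / p.2 = ∑' j : ℕ, (1 / 2 / p.2) * (if Even (j + 1) then
      (u * p.1) ^ (j + 1) / (j + 1) * (j + 1 : ℂ)⁻¹ else 0) := by
    rw [tsum_mul_left, tsum_even_Li₂, hu2, neg_one_mul]
    ring
  have hsum : Summable (fun j : ℕ => (1 / 2 / p.2) * (if Even (j + 1) then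
      (u * p.1) ^ (j + 1) / (j + 1) * (j + 1 : ℂ)⁻¹ else 0)) := by
    refine Summable.mul_left _ ?_
    have := summable_mul_kernel (z := u * p.1) (by rw [norm_mul, hun, one_mul]; exact hz1)
      (k := fun j => if Even (j + 1) then (j + 1 : ℂ)⁻¹ else 0) (C := 1) (fun j => by
        split_ifs
        · exact norm_inv_natCast_succ_le j
        · simp)
    refine this.congr fun j => ?_
    split_ifs <;> simp
  rw [hLi, logGen_eq_tsum_kernel, ← (summable_logGen hz1 hre).tsum_sub hsum]
  refine tsum_congr fun j => ?_
  have := inv_two_sinh_shift hu p.2 (j + 1)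
  push_cast at this
  rw [this]
  split_ifs
  · rw [mul_inv, mul_inv, mul_pow]; ring
  · rw [mul_inv]; ring

lemma continuous_logGen_line {z : ℂ} (hz : ‖z‖ < 1) {η : ℝ} (hη : 0 < η) :
    Continuous (fun α : ℝ => logGen z (η - α * I)) := by
  have hre : ∀ α : ℝ, ((η : ℂ) - α * I).re = η := fun α => by simp
  simp_rw [logGen_eq_tsum_kernel]
  refine continuous_tsum (u := fun j => ‖z‖ ^ j * η⁻¹) ?_
    ((summable_geometric_of_lt_one (norm_nonneg _) hz).mul_right _) ?_
  · intro j
    refine continuous_const.mul (Continuous.inv₀ (by fun_prop) fun α => ?_)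
    refine mul_ne_zero two_ne_zero (sinh_ne_zero_of_re_pos ?_)
    rw [natCast_succ_mul_re, hre]
    positivity
  · intro j α
    have h := norm_inv_two_sinh_le (w := (η : ℂ) - α * I) (by rw [hre]; exact hη) j
    rw [hre] at h
    rw [norm_mul, norm_div, norm_pow, norm_natCast_succ]
    refine mul_le_mul ?_ h (norm_nonneg _) (by positivity)
    refine (div_le_self (by positivity)
      (by linarith [(Nat.cast_nonneg j : (0 : ℝ) ≤ j)])).trans ?_
    exact pow_le_pow_of_le_one (norm_nonneg _) hz.le (Nat.le_succ j)

/-! ### Laplace's method at a saddle point. -/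

/-- The integrand of Cauchy's formula on the circle of radius `exp (-η)`. -/
def cauchyIntegrand (n : ℕ) (z : ℂ) (η α : ℝ) : ℂ :=
  exp (logGen z (η - α * I)) * exp (n * (η - α * I))

lemma continuous_cauchyIntegrand (n : ℕ) {z : ℂ} (hz : ‖z‖ < 1) {η : ℝ} (hη : 0 < η) :
    Continuous (cauchyIntegrand n z η) := by
  unfold cauchyIntegrand
  exact (continuous_exp.comp (continuous_logGen_line hz hη)).mul (by fun_prop)

/-- The fourth root of `n`. -/
def root4 (n : ℕ) : ℝ := √(√(n : ℝ))

lemma root4_pow_four (n : ℕ) : root4 n ^ 4 = n := by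
  rw [root4, show 4 = 2 * 2 by norm_num, pow_mul, Real.sq_sqrt (Real.sqrt_nonneg _),
    Real.sq_sqrt (Nat.cast_nonneg n)]

lemma root4_pos {n : ℕ} (hn : 0 < n) : 0 < root4 n :=
  Real.sqrt_pos.2 (Real.sqrt_pos.2 (by exact_mod_cast hn))

lemma tendsto_root4 : Tendsto root4 atTop atTop :=
  Real.tendsto_sqrt_atTop.comp (Real.tendsto_sqrt_atTop.comp tendsto_natCast_atTop_atTop)

section Saddle

variable {z₀ : ℂ} {A : ℂ → ℂ}

lemma eventually_re_bounds (hA : ContinuousAt A z₀) (hre : 0 < (A z₀).re) :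
    ∀ᶠ p : ℕ × ℂ in atTop ×ˢ 𝓝 z₀, 0 < p.1 ∧ (A z₀).re / 2 < (A p.2).re ∧
      ‖A p.2‖ < ‖A z₀‖ + 1 := by
  have h1 : ∀ᶠ z in 𝓝 z₀, (A z₀).re / 2 < (A z).re :=
    (continuous_re.continuousAt.comp hA).eventually_const_lt (by simpa using by linarith)
  have h2 : ∀ᶠ z in 𝓝 z₀, ‖A z‖ < ‖A z₀‖ + 1 :=
    hA.norm.eventually_lt_const (by simp)
  filter_upwards [tendsto_fst.eventually (eventually_gt_atTop 0), tendsto_snd.eventually h1,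
    tendsto_snd.eventually h2] with p a b c
  exact ⟨a, b, c⟩

/-- The point `(A - i s) / √n` tends to `0` inside a sector. -/
lemma exists_sector_tendsto (hA : ContinuousAt A z₀) (hre : 0 < (A z₀).re) :
    ∃ K : ℝ, 0 ≤ K ∧ Tendsto (fun q : (ℕ × ℂ) × ℝ =>
      (q.1.2, (A q.1.2 - q.2 * I) / (root4 q.1.1 : ℂ) ^ 2))
      ((atTop ×ˢ 𝓝 z₀) ×ˢ 𝓟 (Set.Icc (-1) 1)) (𝓝 z₀ ×ˢ sectorNhds K) := by
  -- Near `z₀` and for `|s| ≤ 1`, `|Im (A - i s)| ≤ ‖A z₀‖ + 2` and `Re (A - i s) ≥ Re (A z₀) / 2`;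
  -- `K` is the quotient.
  refine ⟨(‖A z₀‖ + 2) / ((A z₀).re / 2), by positivity, ?_⟩
  have hev : ∀ᶠ q : (ℕ × ℂ) × ℝ in (atTop ×ˢ 𝓝 z₀) ×ˢ 𝓟 (Set.Icc (-1) 1),
      (0 < q.1.1 ∧ (A z₀).re / 2 < (A q.1.2).re ∧ ‖A q.1.2‖ < ‖A z₀‖ + 1) ∧ |q.2| ≤ 1 := by
    rw [eventually_prod_principal_iff]
    filter_upwards [eventually_re_bounds hA hre] with p hp s hs
    exact ⟨hp, abs_le.2 hs⟩
  refine (tendsto_snd.comp tendsto_fst).prodMk (tendsto_inf.2 ⟨?_, tendsto_principal.2 ?_⟩)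
  · have h1 : Tendsto (fun q : (ℕ × ℂ) × ℝ => (‖A z₀‖ + 2) / root4 q.1.1 ^ 2)
        ((atTop ×ˢ 𝓝 z₀) ×ˢ 𝓟 (Set.Icc (-1) 1)) (𝓝 0) := by
      refine Tendsto.div_atTop tendsto_const_nhds ?_
      exact (tendsto_pow_atTop two_ne_zero).comp
        (tendsto_root4.comp (tendsto_fst.comp tendsto_fst))
    refine squeeze_zero_norm' ?_ h1
    filter_upwards [hev] with q hq
    rw [norm_div, norm_pow, norm_real, Real.norm_eq_abs, sq_abs]
    gcongr
    refine (norm_sub_le _ _).trans ?_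
    rw [norm_mul, norm_I, norm_real, Real.norm_eq_abs]
    linarith [hq.1.2.2, hq.2]
  · filter_upwards [hev] with q hq
    have hr := root4_pos hq.1.1
    have e : (A q.1.2 - q.2 * I) / (root4 q.1.1 : ℂ) ^ 2 =
        ((root4 q.1.1 ^ 2)⁻¹ : ℝ) * (A q.1.2 - q.2 * I) := by
      push_cast; rw [div_eq_inv_mul]
    have hc : 0 < (A z₀).re / 2 := by linarith
    have hi : 0 < (root4 q.1.1 ^ 2)⁻¹ := by positivity
    rw [e]
    constructor
    · rw [re_ofReal_mul]
      have : (A q.1.2 - q.2 * I).re = (A q.1.2).re := by simp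
      rw [this]
      exact mul_pos hi (hc.trans hq.1.2.1)
    · rw [re_ofReal_mul, im_ofReal_mul, abs_mul, abs_of_pos hi]
      have h1 : (A q.1.2 - q.2 * I).re = (A q.1.2).re := by simp
      have h2 : (A q.1.2 - q.2 * I).im = (A q.1.2).im - q.2 := by simp
      rw [h1, h2]
      have h3 : |(A q.1.2).im - q.2| ≤ ‖A z₀‖ + 2 := by
        refine (abs_sub _ _).trans ?_
        linarith [abs_im_le_norm (A q.1.2), hq.1.2.2, hq.2]
      have h4 : ‖A z₀‖ + 2 ≤ (‖A z₀‖ + 2) / ((A z₀).re / 2) * (A q.1.2).re := by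
        rw [div_mul_eq_mul_div, le_div_iff₀ hc]
        exact mul_le_mul_of_nonneg_left hq.1.2.1.le (by positivity)
      calc (root4 q.1.1 ^ 2)⁻¹ * |(A q.1.2).im - q.2|
          ≤ (root4 q.1.1 ^ 2)⁻¹ * ((‖A z₀‖ + 2) / ((A z₀).re / 2) * (A q.1.2).re) := by
            gcongr; exact h3.trans h4
        _ = _ := by ring

/-- Completing the square at the saddle point. -/
lemma saddle_identity {a : ℂ} {r t : ℝ} (hr : 0 < r) (ha : 0 < a.re) :
    a ^ 2 / ((a - (t / r : ℝ) * I) / (r : ℂ) ^ 2) +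
      (r : ℂ) ^ 4 * ((a - (t / r : ℝ) * I) / (r : ℂ) ^ 2) - 2 * a * (r : ℂ) ^ 2 =
      -(t : ℂ) ^ 2 / (a - (t / r : ℝ) * I) := by
  have h1 : a - (t / r : ℝ) * I ≠ 0 := by
    intro h
    have := congrArg re h
    simp at this
    linarith
  have hr' : (r : ℂ) ≠ 0 := by exact_mod_cast hr.ne'
  have h2 : (t : ℂ) = r * (t / r : ℝ) := by push_cast; field_simp
  rw [h2]
  set s : ℂ := ((t / r : ℝ) : ℂ)
  have hI : I ^ 2 = -1 := I_sq
  field_simp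
  linear_combination s ^ 2 * hI

/-- The real part of `1 / (a - i s)` is `Re a / ‖a - i s‖ ^ 2`, bounded below by `c / M ^ 2`. This
is the Gaussian majorant for the window. -/
lemma norm_exp_gaussian_le {a : ℂ} {s t c M : ℝ} (hc : 0 < c) (ha : c ≤ a.re)
    (hM : ‖a - s * I‖ ≤ M) :
    ‖exp (-(t : ℂ) ^ 2 / (a - s * I))‖ ≤ Real.exp (-(c / M ^ 2) * t ^ 2) := by
  have hre : (a - s * I).re = a.re := by simp
  have hpos : 0 < ‖a - s * I‖ := norm_pos_iff.2 fun h => by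
    rw [h] at hre; simp at hre; linarith
  rw [norm_exp]
  refine Real.exp_le_exp.2 ?_
  have e : -(t : ℂ) ^ 2 / (a - s * I) = ((-t ^ 2 : ℝ) : ℂ) * (a - s * I)⁻¹ := by
    push_cast; rw [div_eq_mul_inv]
  rw [e, re_ofReal_mul, inv_re, hre, normSq_eq_norm_sq]
  have ha0 : 0 ≤ a.re := hc.le.trans ha
  have h1 : c / M ^ 2 ≤ a.re / ‖a - s * I‖ ^ 2 := by gcongr
  nlinarith [mul_le_mul_of_nonneg_left h1 (sq_nonneg t)]

/-- Laplace's method on the window of width `n ^ (-1/2)` around a saddle point. -/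
theorem tendsto_window (hz : ‖z₀‖ < 1) (hA : ContinuousAt A z₀) (hre : 0 < (A z₀).re) {α₀ : ℝ}
    {e₀ : ℂ} (hE : ∀ K : ℝ, 0 ≤ K → Tendsto (fun p : ℂ × ℂ =>
      logGen p.1 (p.2 - α₀ * I) - A p.1 ^ 2 / p.2) (𝓝 z₀ ×ˢ sectorNhds K) (𝓝 e₀)) :
    Tendsto (fun p : ℕ × ℂ => ((root4 p.1 : ℂ) ^ 3 * (exp (-(2 * A p.2 * (root4 p.1 : ℂ) ^ 2)) *
      exp (p.1 * (α₀ * I)))) *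
      ∫ α in (α₀ - (A p.2).im / root4 p.1 ^ 2 - 1 / root4 p.1 ^ 2)..
        (α₀ - (A p.2).im / root4 p.1 ^ 2 + 1 / root4 p.1 ^ 2),
        cauchyIntegrand p.1 p.2 ((A p.2).re / root4 p.1 ^ 2) α)
      (atTop ×ˢ 𝓝 z₀) (𝓝 ((Real.pi * A z₀) ^ (1 / 2 : ℂ) * exp e₀)) := by
  obtain ⟨K, hK, hsec⟩ := exists_sector_tendsto hA hre
  set l : Filter (ℕ × ℂ) := atTop ×ˢ 𝓝 z₀ with hl
  have hEs := (hE K hK).comp hsec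
  have hev : ∀ᶠ p : ℕ × ℂ in l, (0 < p.1 ∧ (A z₀).re / 2 < (A p.2).re ∧
      ‖A p.2‖ < ‖A z₀‖ + 1) ∧ ‖p.2‖ < 1 :=
    (eventually_re_bounds hA hre).and
      (tendsto_snd.norm.eventually_lt_const hz : ∀ᶠ p : ℕ × ℂ in atTop ×ˢ 𝓝 z₀, ‖p.2‖ < 1)
  -- Substituting `α = centre + t / n ^ (3/4)` puts the local variable at `(A - i t / n ^ (1/4)) /
  -- √n`. The saddle exponent is then exactly `-t ^ 2 / (A - i t / n ^ (1/4))`, with no Taylor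
  -- remainder.
  have hform : ∀ p : ℕ × ℂ, 0 < p.1 → 0 < (A p.2).re → ∀ t : ℝ,
      (exp (-(2 * A p.2 * (root4 p.1 : ℂ) ^ 2)) * exp (p.1 * (α₀ * I))) *
        cauchyIntegrand p.1 p.2 ((A p.2).re / root4 p.1 ^ 2)
          (α₀ - (A p.2).im / root4 p.1 ^ 2 + 1 / root4 p.1 ^ 3 * t) =
      exp (logGen p.2 ((A p.2 - (t / root4 p.1 : ℝ) * I) / (root4 p.1 : ℂ) ^ 2 - α₀ * I) -
        A p.2 ^ 2 / ((A p.2 - (t / root4 p.1 : ℝ) * I) / (root4 p.1 : ℂ) ^ 2)) *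
      exp (-(t : ℂ) ^ 2 / (A p.2 - (t / root4 p.1 : ℝ) * I)) := by
    intro p hp hap t
    have hr := root4_pos hp
    have hr' : (root4 p.1 : ℂ) ≠ 0 := by exact_mod_cast hr.ne'
    have hw : (((A p.2).re / root4 p.1 ^ 2 : ℝ) : ℂ) -
        ((α₀ - (A p.2).im / root4 p.1 ^ 2 + 1 / root4 p.1 ^ 3 * t : ℝ) : ℂ) * I =
        (A p.2 - (t / root4 p.1 : ℝ) * I) / (root4 p.1 : ℂ) ^ 2 - α₀ * I := by
      conv_rhs => rw [← re_add_im (A p.2)]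
      push_cast
      field_simp
      ring
    have hn : (p.1 : ℂ) = (root4 p.1 : ℂ) ^ 4 := by
      exact_mod_cast congrArg (fun x : ℝ => (x : ℂ)) (root4_pow_four p.1).symm
    rw [cauchyIntegrand, hw, ← saddle_identity hr hap, ← exp_add, ← exp_add, ← exp_add, ← exp_add,
      hn]
    congr 1
    ring
  -- The window becomes `|t| ≤ n ^ (1/4)`; the indicator turns it into an integral over the fixed
  -- domain `ℝ`, ready for dominated convergence.
  set F : ℕ × ℂ → ℝ → ℂ := fun p => (Set.Ioc (-root4 p.1) (root4 p.1)).indicator fun t =>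
    (exp (-(2 * A p.2 * (root4 p.1 : ℂ) ^ 2)) * exp (p.1 * (α₀ * I))) *
        cauchyIntegrand p.1 p.2 ((A p.2).re / root4 p.1 ^ 2)
          (α₀ - (A p.2).im / root4 p.1 ^ 2 + 1 / root4 p.1 ^ 3 * t) with hF
  have hsub : ∀ᶠ p in l, ∫ t, F p t = ((root4 p.1 : ℂ) ^ 3 *
      (exp (-(2 * A p.2 * (root4 p.1 : ℂ) ^ 2)) * exp (p.1 * (α₀ * I)))) *
      ∫ α in (α₀ - (A p.2).im / root4 p.1 ^ 2 - 1 / root4 p.1 ^ 2)..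
        (α₀ - (A p.2).im / root4 p.1 ^ 2 + 1 / root4 p.1 ^ 2),
        cauchyIntegrand p.1 p.2 ((A p.2).re / root4 p.1 ^ 2) α := by
    filter_upwards [hev] with p hp
    have hr := root4_pos hp.1.1
    have hr' : (root4 p.1 : ℂ) ≠ 0 := by exact_mod_cast hr.ne'
    rw [hF]
    simp only
    rw [MeasureTheory.integral_indicator measurableSet_Ioc,
      ← intervalIntegral.integral_of_le (by linarith), intervalIntegral.integral_const_mul]
    have hs := intervalIntegral.smul_integral_comp_add_mul (a := -root4 p.1) (b := root4 p.1)
      (fun α => cauchyIntegrand p.1 p.2 ((A p.2).re / root4 p.1 ^ 2) α) (1 / root4 p.1 ^ 3)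
      (α₀ - (A p.2).im / root4 p.1 ^ 2)
    have e1 : α₀ - (A p.2).im / root4 p.1 ^ 2 + 1 / root4 p.1 ^ 3 * -root4 p.1 =
        α₀ - (A p.2).im / root4 p.1 ^ 2 - 1 / root4 p.1 ^ 2 := by field_simp; ring
    have e2 : α₀ - (A p.2).im / root4 p.1 ^ 2 + 1 / root4 p.1 ^ 3 * root4 p.1 =
        α₀ - (A p.2).im / root4 p.1 ^ 2 + 1 / root4 p.1 ^ 2 := by field_simp
    rw [e1, e2] at hs
    rw [← hs, real_smul]
    push_cast
    field_simp
  refine Tendsto.congr' hsub ?_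
  have hgauss : ∫ t : ℝ, exp e₀ * exp (-(t : ℂ) ^ 2 / A z₀) =
      (Real.pi * A z₀) ^ (1 / 2 : ℂ) * exp e₀ := by
    have hinv : 0 < ((A z₀)⁻¹).re := by
      rw [inv_re]
      exact div_pos hre (normSq_pos.2 fun h => by simp [h] at hre)
    have := integral_gaussian_complex hinv
    rw [div_inv_eq_mul] at this
    rw [MeasureTheory.integral_const_mul, ← this, mul_comm]
    congr 2
    ext t
    congr 1
    ring
  rw [← hgauss]
  set c := (A z₀).re / 2 with hc
  set M := ‖A z₀‖ + 2 with hM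
  have hcpos : 0 < c := by rw [hc]; linarith
  have hMpos : 0 < M := by rw [hM]; positivity
  have hEb : ∀ᶠ p : ℕ × ℂ in l, ∀ s ∈ Set.Icc (-1 : ℝ) 1,
      ‖logGen p.2 ((A p.2 - s * I) / (root4 p.1 : ℂ) ^ 2 - α₀ * I) -
        A p.2 ^ 2 / ((A p.2 - s * I) / (root4 p.1 : ℂ) ^ 2)‖ < ‖e₀‖ + 1 :=
    eventually_prod_principal_iff.1 (hEs.norm.eventually_lt_const (by simp))
  refine MeasureTheory.tendsto_integral_filter_of_dominated_convergence
    (fun t => Real.exp (‖e₀‖ + 1) * Real.exp (-(c / M ^ 2) * t ^ 2)) ?_ ?_ ?_ ?_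
  · filter_upwards [hev] with p hp
    refine MeasureTheory.AEStronglyMeasurable.indicator ?_ measurableSet_Ioc
    refine Continuous.aestronglyMeasurable (continuous_const.mul ?_)
    refine (continuous_cauchyIntegrand _ hp.2 ?_).comp (by fun_prop)
    have := root4_pos hp.1.1
    have := hcpos.trans hp.1.2.1
    positivity
  · filter_upwards [hev, hEb] with p hp hEp
    refine Eventually.of_forall fun t => ?_
    rw [hF]
    simp only
    by_cases ht : t ∈ Set.Ioc (-root4 p.1) (root4 p.1)
    · have hr := root4_pos hp.1.1
      rw [Set.indicator_of_mem ht, hform p hp.1.1 (hcpos.trans hp.1.2.1), norm_mul]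
      have hs : t / root4 p.1 ∈ Set.Icc (-1 : ℝ) 1 := by
        constructor
        · rw [le_div_iff₀ hr]; linarith [ht.1]
        · rw [div_le_iff₀ hr]; linarith [ht.2]
      refine mul_le_mul ?_ ?_ (norm_nonneg _) (Real.exp_pos _).le
      · exact (norm_exp_le_exp_norm _).trans (Real.exp_le_exp.2 (hEp _ hs).le)
      · refine norm_exp_gaussian_le hcpos hp.1.2.1.le ?_
        refine (norm_sub_le _ _).trans ?_
        rw [norm_mul, norm_I, norm_real, Real.norm_eq_abs]
        linarith [hp.1.2.2, abs_le.2 hs]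
    · rw [Set.indicator_of_notMem ht, norm_zero]
      positivity
  · exact (integrable_exp_neg_mul_sq (by positivity)).const_mul _
  · refine Eventually.of_forall fun t => ?_
    have hs0 : Tendsto (fun p : ℕ × ℂ => t / root4 p.1) l (𝓝 0) :=
      tendsto_const_nhds.div_atTop (tendsto_root4.comp tendsto_fst)
    have hs1 : Tendsto (fun p : ℕ × ℂ => (p, t / root4 p.1)) l (l ×ˢ 𝓟 (Set.Icc (-1) 1)) := by
      refine tendsto_id.prodMk (tendsto_principal.2 ?_)
      exact hs0.eventually (Icc_mem_nhds (by norm_num) (by norm_num))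
    have h1 := (continuous_exp.tendsto _).comp (hEs.comp hs1)
    have hA0 : A z₀ ≠ 0 := fun h => by simp [h] at hre
    have h2 : Tendsto (fun p : ℕ × ℂ => A p.2 - (t / root4 p.1 : ℝ) * I) l (𝓝 (A z₀)) := by
      have h3 : Tendsto (fun p : ℕ × ℂ => A p.2) l (𝓝 (A z₀)) := hA.tendsto.comp tendsto_snd
      have h4 := ((continuous_ofReal.tendsto _).comp hs0).mul_const I
      simpa using h3.sub h4
    have h3 := (continuous_exp.tendsto _).comp ((tendsto_const_nhds (x := -(t : ℂ) ^ 2)).div h2 hA0)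
    refine (h1.mul h3).congr' ?_
    have hbig : ∀ᶠ p : ℕ × ℂ in l, |t| < root4 p.1 :=
      (tendsto_root4.comp tendsto_fst).eventually (eventually_gt_atTop |t|)
    filter_upwards [hev, hbig] with p hp ht
    have hmem : t ∈ Set.Ioc (-root4 p.1) (root4 p.1) := by
      have := abs_lt.1 ht
      exact ⟨this.1, this.2.le⟩
    rw [hF]
    simp only
    rw [Set.indicator_of_mem hmem, hform p hp.1.1 (hcpos.trans hp.1.2.1)]
    rfl

end Saddle

/-! ### Ultrafilter limits and the classification of resonances. -/

/-- If all ultrafilter limits of `f` along `l` are below `V`, then so is `f`, with a gap. -/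
lemma exists_gap {ι : Type*} {l : Filter ι} {f : ι → ℝ} {V : ℝ}
    (h : ∀ U : Ultrafilter ι, (U : Filter ι) ≤ l → ∃ v < V, Tendsto f U (𝓝 v)) :
    ∃ δ > 0, ∀ᶠ x in l, f x ≤ V - δ := by
  by_contra! hcon
  -- The gap `δ` is made a variable: if every `δ` fails, an ultrafilter on pairs `(δ, x)` with `δ →
  -- 0+` and `V - δ < f x` exists, and along it the limit of `f` is at least `V`.
  set T : Set (ℝ × ι) := {q | V - q.1 < f q.2} with hT
  have hfreq : ∃ᶠ q in 𝓝[>] (0 : ℝ) ×ˢ l, q ∈ T := by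
    intro hev
    have h2 := (hev.curry.and self_mem_nhdsWithin).exists
    obtain ⟨δ, h3, h4⟩ := h2
    refine hcon δ h4 (h3.mono fun x hx => ?_)
    exact hx
  have hne : NeBot ((𝓝[>] (0 : ℝ) ×ˢ l) ⊓ 𝓟 T) := frequently_mem_iff_neBot.1 hfreq
  set W := Ultrafilter.of ((𝓝[>] (0 : ℝ) ×ˢ l) ⊓ 𝓟 T) with hW
  have hWle : (W : Filter (ℝ × ι)) ≤ (𝓝[>] (0 : ℝ) ×ˢ l) ⊓ 𝓟 T := Ultrafilter.of_le _
  have h1 : Tendsto Prod.snd (W : Filter (ℝ × ι)) l :=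
    tendsto_snd.mono_left (hWle.trans inf_le_left)
  have h0 : Tendsto (fun q : ℝ × ι => V - q.1) (W : Filter (ℝ × ι)) (𝓝 V) := by
    have : Tendsto Prod.fst (W : Filter (ℝ × ι)) (𝓝 (0 : ℝ)) :=
      (tendsto_fst.mono_left (hWle.trans inf_le_left)).mono_right nhdsWithin_le_nhds
    simpa using this.const_sub V
  obtain ⟨v, hv, hlim⟩ := h (W.map Prod.snd) h1
  have h2 : Tendsto (fun q : ℝ × ι => f q.2) (W : Filter (ℝ × ι)) (𝓝 v) := by
    rw [Ultrafilter.coe_map, tendsto_map'_iff] at hlim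
    exact hlim
  have h3 : ∀ᶠ q in (W : Filter (ℝ × ι)), V - q.1 ≤ f q.2 := by
    have : ∀ᶠ q in (W : Filter (ℝ × ι)), q ∈ T := (hWle.trans inf_le_right) (mem_principal_self T)
    exact this.mono fun q hq => le_of_lt hq
  exact absurd (le_of_tendsto_of_tendsto h0 h2 h3) (not_le.2 hv)

section Classification

variable {ι : Type*} {U : Ultrafilter ι} {η α : ι → ℝ}

/-- The integers `k` such that `k * α` is within `O(η)` of a multiple of `π`. -/
def resonances (U : Ultrafilter ι) (η α : ι → ℝ) : AddSubgroup ℤ where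
  carrier := {k | ∃ C : ℝ, ∀ᶠ i in (U : Filter ι), ∃ m : ℤ, |k * α i - Real.pi * m| ≤ C * η i}
  zero_mem' := ⟨0, Eventually.of_forall fun i => ⟨0, by simp⟩⟩
  add_mem' := by
    rintro a b ⟨C, hC⟩ ⟨D, hD⟩
    refine ⟨C + D, ?_⟩
    filter_upwards [hC, hD] with i ⟨m, hm⟩ ⟨k, hk⟩
    refine ⟨m + k, ?_⟩
    have e : ((a + b : ℤ) : ℝ) * α i - Real.pi * ((m + k : ℤ) : ℝ) =
        (a * α i - Real.pi * m) + (b * α i - Real.pi * k) := by push_cast; ring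
    rw [e, add_mul]
    exact (abs_add_le _ _).trans (add_le_add hm hk)
  neg_mem' := by
    rintro a ⟨C, hC⟩
    refine ⟨C, hC.mono ?_⟩
    rintro i ⟨m, hm⟩
    refine ⟨-m, ?_⟩
    rw [← abs_neg]
    refine le_of_eq_of_le ?_ hm
    congr 1
    push_cast
    ring

lemma mem_resonances {k : ℤ} : k ∈ resonances U η α ↔
    ∃ C : ℝ, ∀ᶠ i in (U : Filter ι), ∃ m : ℤ, |k * α i - Real.pi * m| ≤ C * η i := Iff.rfl

/-- Jordan's inequality at the nearest multiple of `π`, with `2 / π` weakened to `1 / 2`. -/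
lemma exists_int_abs_sin_ge (y : ℝ) : ∃ m : ℤ, |y - Real.pi * m| / 2 ≤ |Real.sin y| := by
  refine ⟨round (y / Real.pi), ?_⟩
  have hpi := Real.pi_pos
  have h1 : |y - Real.pi * round (y / Real.pi)| ≤ Real.pi / 2 := by
    have h := abs_sub_round (y / Real.pi)
    have e : y - Real.pi * round (y / Real.pi) =
        Real.pi * (y / Real.pi - round (y / Real.pi)) := by field_simp
    rw [e, abs_mul, abs_of_pos hpi]
    nlinarith
  have h2 := Real.mul_abs_le_abs_sin h1
  have h3 : |Real.sin (y - Real.pi * round (y / Real.pi))| = |Real.sin y| := by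
    rw [mul_comm, Real.sin_sub_int_mul_pi, abs_mul]
    simp
  rw [h3] at h2
  refine le_trans ?_ h2
  rw [div_eq_inv_mul]
  refine mul_le_mul_of_nonneg_right ?_ (abs_nonneg _)
  rw [le_div_iff₀ hpi]
  linarith [Real.pi_le_four]

/-- The kernel of the rescaled logarithmic series. -/
def kernel (η α : ι → ℝ) (j : ℕ) (i : ι) : ℂ :=
  η i * (2 * sinh ((j + 1 : ℂ) * (η i - α i * I)))⁻¹

/-- Off resonance the distance from `(j + 1) α` to `π ℤ` exceeds every multiple of `η`, hence so
does `‖sinh‖`, through the sine of the imaginary part. -/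
lemma tendsto_kernel_of_notMem (hη : ∀ᶠ i in (U : Filter ι), 0 < η i) {j : ℕ}
    (hj : ((j + 1 : ℕ) : ℤ) ∉ resonances U η α) : Tendsto (kernel η α j) U (𝓝 0) := by
  rw [mem_resonances] at hj
  -- For an ultrafilter, failing to hold eventually is the same as eventually failing.
  push Not at hj
  rw [Metric.tendsto_nhds]
  intro ε hε
  filter_upwards [hj (2 / ε), hη] with i hi hpos
  obtain ⟨m, hm⟩ := exists_int_abs_sin_ge ((j + 1) * α i)
  have h2 := hi m
  push_cast at h2
  have h3 := abs_sin_im_le_norm_sinh ((j + 1 : ℂ) * (η i - α i * I))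
  have him : ((j + 1 : ℂ) * (η i - α i * I)).im = -((j + 1) * α i) := by
    rw [natCast_succ_mul_im]; simp
  rw [him, Real.sin_neg, abs_neg] at h3
  have h4 : η i / ε < ‖sinh ((j + 1 : ℂ) * (η i - α i * I))‖ := by
    have : 2 / ε * η i / 2 = η i / ε := by ring
    linarith
  have h5 : 0 < ‖sinh ((j + 1 : ℂ) * (η i - α i * I))‖ := (div_pos hpos hε).trans h4
  rw [dist_zero_right, kernel, norm_mul, norm_inv, norm_mul, norm_real, Real.norm_eq_abs,
    abs_of_pos hpos, ← div_eq_mul_inv, div_lt_iff₀ (mul_pos (by simp) h5)]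
  rw [div_lt_iff₀ hε] at h4
  have : ‖(2 : ℂ)‖ = 2 := by simp
  rw [this]
  nlinarith

lemma exp_int_mul_pi_I (m : ℤ) :
    exp (m * (Real.pi * I)) = if Even m then 1 else -1 := by
  split_ifs with h
  · obtain ⟨k, rfl⟩ := h
    rw [← exp_int_mul_two_pi_mul_I k]
    congr 1
    push_cast
    ring
  · obtain ⟨k, rfl⟩ := Int.not_even_iff_odd.1 h
    rw [show ((2 * k + 1 : ℤ) : ℂ) * (Real.pi * I) = k * (2 * Real.pi * I) + Real.pi * I by
      push_cast; ring, exp_add, exp_int_mul_two_pi_mul_I, exp_pi_mul_I, one_mul]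

lemma sinh_sub_nat_mul {ε : ℂ} (hε : ε = 1 ∨ ε = -1) {Y : ℂ} (hY : exp Y = ε) (X : ℂ) (l : ℕ) :
    sinh (X - l * Y) = ε ^ l * sinh X := by
  have hinv : (ε ^ l)⁻¹ = ε ^ l := by
    rw [← inv_pow]; rcases hε with rfl | rfl <;> simp
  rw [sinh, sinh, neg_sub, exp_sub, sub_eq_add_neg (l * Y), exp_add, exp_nat_mul, hY,
    div_eq_mul_inv (exp X), hinv]
  ring

/-- Up to `(l + 1) π i m`, the argument of `sinh` is `X = (l + 1) η (g - i t)` with `t → τ`. The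
period contributes the sign `ε ^ (l + 1)`, and `η / sinh X` behaves like `η / X`, because `X` stays
in a fixed sector. -/
lemma tendsto_kernel_of_dvd (hη : ∀ᶠ i in (U : Filter ι), 0 < η i) (hη0 : Tendsto η U (𝓝 0))
    {g : ℕ} (hg : 0 < g) {m : ι → ℤ} {ε : ℂ} (hε : ε = 1 ∨ ε = -1)
    (hm : ∀ᶠ i in (U : Filter ι), exp (m i * (Real.pi * I)) = ε) {τ : ℝ}
    (hτ : Tendsto (fun i => (g * α i - Real.pi * m i) / η i) U (𝓝 τ)) (j l : ℕ)
    (hj : j + 1 = g * (l + 1)) :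
    Tendsto (kernel η α j) U (𝓝 (ε ^ (l + 1) / (2 * (l + 1) * (g - τ * I)))) := by
  set t : ι → ℝ := fun i => (g * α i - Real.pi * m i) / η i with ht
  set X : ι → ℂ := fun i => (l + 1 : ℂ) * (η i * (g - t i * I)) with hX
  have hform : ∀ᶠ i in (U : Filter ι), kernel η α j i =
      ε ^ (l + 1) / 2 * (η i * ((sinh (X i))⁻¹ - (X i)⁻¹) +
        ((l + 1 : ℂ) * (g - t i * I))⁻¹) := by
    filter_upwards [hη, hm] with i hi hmi
    have hi' : (η i : ℂ) ≠ 0 := by exact_mod_cast hi.ne'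
    have e1 : (j + 1 : ℂ) * (η i - α i * I) = X i - ((l + 1 : ℕ) : ℂ) * (m i * (Real.pi * I)) := by
      have : (j + 1 : ℂ) = g * (l + 1) := by exact_mod_cast hj
      rw [this, hX, ht]
      push_cast
      field_simp
      ring
    have hinv : (ε ^ (l + 1))⁻¹ = ε ^ (l + 1) := by
      rw [← inv_pow]; rcases hε with rfl | rfl <;> simp
    have e2 : (η i : ℂ) * (X i)⁻¹ = ((l + 1 : ℂ) * (g - t i * I))⁻¹ := by
      rw [hX]
      simp only
      rw [mul_left_comm, mul_inv (η i : ℂ), mul_inv_cancel_left₀ hi']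
    rw [kernel, e1, sinh_sub_nat_mul hε hmi, ← e2, mul_inv, mul_inv, hinv]
    ring
  have hgne : ∀ s : ℝ, ((l + 1 : ℂ) * (g - s * I)) ≠ 0 := by
    intro s h
    rcases mul_eq_zero.1 h with h | h
    · exact natCast_succ_ne_zero l h
    · have := congrArg re h
      simp at this
      omega
  have hC : ∀ᶠ i in (U : Filter ι), |t i| < |τ| + 1 := hτ.abs.eventually_lt_const (by simp)
  have h1 : Tendsto (fun i => (η i : ℂ) * ((sinh (X i))⁻¹ - (X i)⁻¹)) U (𝓝 0) := by
    have h2 : Tendsto (fun i => η i * (2 * (|τ| + 1 + 1))) U (𝓝 0) := by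
      simpa using hη0.mul_const (2 * (|τ| + 1 + 1))
    refine squeeze_zero_norm' ?_ h2
    filter_upwards [hC, hη] with i hi hpos
    rw [norm_mul, norm_real, Real.norm_eq_abs, abs_of_pos hpos]
    refine mul_le_mul_of_nonneg_left ?_ hpos.le
    refine norm_inv_sinh_sub_inv_le' (by positivity) (mul_mem_sector ?_ l)
    have hg1 : (1 : ℝ) ≤ g := by exact_mod_cast hg
    constructor
    · rw [re_ofReal_mul]
      simp
      positivity
    · rw [re_ofReal_mul, im_ofReal_mul, abs_mul, abs_of_pos hpos]
      simp
      nlinarith [mul_le_mul_of_nonneg_left hi.le hpos.le, mul_nonneg (mul_nonneg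
        (add_nonneg (abs_nonneg τ) zero_le_one) hpos.le) (sub_nonneg.2 hg1)]
  have h3 : Tendsto (fun i => ((l + 1 : ℂ) * (g - t i * I))⁻¹) U
      (𝓝 ((l + 1 : ℂ) * (g - τ * I))⁻¹) := by
    refine Tendsto.inv₀ ?_ (hgne τ)
    exact (tendsto_const_nhds.sub
      (((continuous_ofReal.tendsto _).comp hτ).mul_const I)).const_mul _
  have h4 := ((h1.add h3).const_mul (ε ^ (l + 1) / 2))
  have e : ε ^ (l + 1) / 2 * (0 + ((l + 1 : ℂ) * (g - τ * I))⁻¹) =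
      ε ^ (l + 1) / (2 * (l + 1) * (g - τ * I)) := by
    rw [zero_add, ← div_eq_mul_inv, div_div, mul_assoc]
  rw [e] at h4
  exact h4.congr' (hform.mono fun i hi => hi.symm)

lemma tendsto_mul_logGen_of_kernel (hη : ∀ᶠ i in (U : Filter ι), 0 < η i) {z₀ : ℂ}
    (hz : ‖z₀‖ < 1) {z : ι → ℂ} (hzt : Tendsto z U (𝓝 z₀)) {c : ℕ → ℂ}
    (hk : ∀ j, Tendsto (kernel η α j) U (𝓝 (c j))) :
    Tendsto (fun i => η i * logGen (z i) (η i - α i * I)) U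
      (𝓝 (∑' j : ℕ, z₀ ^ (j + 1) / (j + 1) * c j)) := by
  refine (tendsto_tsum_kernel (C := 1) hz hzt hk ?_).congr fun i => ?_
  · filter_upwards [hη] with i hi j
    have hre : ((η i : ℂ) - α i * I).re = η i := by simp
    have := norm_inv_two_sinh_le (w := (η i : ℂ) - α i * I) (by rw [hre]; exact hi) j
    rw [hre] at this
    rw [kernel, norm_mul, norm_real, Real.norm_eq_abs, abs_of_pos hi]
    calc η i * _ ≤ η i * (η i)⁻¹ := mul_le_mul_of_nonneg_left this hi.le
      _ = 1 := mul_inv_cancel₀ hi.ne'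
  · rw [logGen_eq_tsum_kernel, ← tsum_mul_left]
    refine tsum_congr fun j => ?_
    rw [kernel]
    ring

/-- Only multiples of `g` survive; the factor `1 / (l + 1)` of the kernel together with that of the
logarithmic series rebuilds the dilogarithm at `ε z ^ g`. -/
lemma tsum_resonant (z ε b : ℂ) {g : ℕ} (hg : 0 < g) {c : ℕ → ℂ}
    (hc : ∀ j l : ℕ, j + 1 = g * (l + 1) → c j = ε ^ (l + 1) / (2 * (l + 1) * b))
    (hc0 : ∀ j : ℕ, ¬ g ∣ j + 1 → c j = 0) :
    ∑' j : ℕ, z ^ (j + 1) / (j + 1) * c j = 1 / 2 * Li₂ (ε * z ^ g) / (g * b) := by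
  have hsub : ∀ l : ℕ, g * (l + 1) - 1 + 1 = g * (l + 1) := fun l =>
    Nat.sub_add_cancel (Nat.mul_pos hg (Nat.succ_pos l))
  have hinj : Function.Injective (fun l : ℕ => g * (l + 1) - 1) := by
    intro a b h
    have h1 : g * (a + 1) = g * (b + 1) := by
      rw [← hsub a, ← hsub b]; exact congrArg (· + 1) h
    have := Nat.eq_of_mul_eq_mul_left hg h1
    omega
  rw [← hinj.tsum_eq]
  · rw [Li₂, mul_div_right_comm, ← tsum_mul_left]
    refine tsum_congr fun l => ?_
    rw [hc _ l (hsub l), hsub l]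
    have e : (((g * (l + 1) - 1 : ℕ) : ℂ) + 1) = g * (l + 1) := by exact_mod_cast hsub l
    rw [e, mul_pow, ← pow_mul]
    field_simp
  · intro j hj
    by_cases hd : g ∣ j + 1
    · obtain ⟨l, hl⟩ := hd
      rcases l with _ | l
      · simp at hl
      · exact ⟨l, by simp only; rw [← hl]; simp⟩
    · simp [hc0 j hd] at hj

/-- The possible limits of `η * log G` along an ultrafilter. -/
theorem classification (hη : ∀ᶠ i in (U : Filter ι), 0 < η i) (hη0 : Tendsto η U (𝓝 0)) {z₀ : ℂ}
    (hz : ‖z₀‖ < 1) {z : ι → ℂ} (hzt : Tendsto z U (𝓝 z₀)) :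
    Tendsto (fun i => η i * logGen (z i) (η i - α i * I)) U (𝓝 0) ∨
    ∃ (g : ℕ) (ε : ℂ) (m : ι → ℤ) (τ : ℝ), 0 < g ∧
      ((ε = 1 ∧ Odd g ∧ ∀ᶠ i in (U : Filter ι), Even (m i)) ∨
        (ε = -1 ∧ ∀ᶠ i in (U : Filter ι), Odd (m i))) ∧
      Tendsto (fun i => (g * α i - Real.pi * m i) / η i) U (𝓝 τ) ∧
      Tendsto (fun i => η i * logGen (z i) (η i - α i * I)) U
        (𝓝 (1 / 2 * Li₂ (ε * z₀ ^ g) / (g * (g - τ * I)))) := by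
  obtain ⟨a, ha⟩ := Int.subgroup_cyclic (resonances U η α)
  have hmem : ∀ k : ℤ, k ∈ resonances U η α ↔ a ∣ k := by
    intro k
    rw [ha, AddSubgroup.mem_closure_singleton]
    constructor
    · rintro ⟨n, rfl⟩; exact ⟨n, by simp [mul_comm]⟩
    · rintro ⟨n, rfl⟩; exact ⟨n, by simp [mul_comm]⟩
  rcases eq_or_ne a 0 with rfl | ha0
  · left
    have h := tendsto_mul_logGen_of_kernel (α := α) hη hz hzt (c := fun _ => 0) (fun j => by
      refine tendsto_kernel_of_notMem hη ?_
      rw [hmem, zero_dvd_iff]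
      exact_mod_cast Nat.succ_ne_zero j)
    simpa using h
  · right
    set g := a.natAbs with hgdef
    have hg : 0 < g := Int.natAbs_pos.2 ha0
    have hmem' : ∀ k : ℕ, (k : ℤ) ∈ resonances U η α ↔ g ∣ k := by
      intro k
      rw [hmem, ← Int.natAbs_dvd, Int.natCast_dvd_natCast]
    obtain ⟨C, hC⟩ := mem_resonances.1 ((hmem' g).2 dvd_rfl)
    obtain ⟨m, hm⟩ := hC.choice
    have hbound : ∀ᶠ i in (U : Filter ι),
        (g * α i - Real.pi * m i) / η i ∈ Set.Icc (-C) C := by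
      filter_upwards [hm, hη] with i h1 h2
      rw [Set.mem_Icc, ← abs_le, abs_div, abs_of_pos h2, div_le_iff₀ h2]
      exact_mod_cast h1
    -- Resonance keeps the rescaled offset in a compact interval, so it has a limit along the
    -- ultrafilter.
    obtain ⟨τ, -, hτ⟩ := (isCompact_Icc (a := -C) (b := C)).ultrafilter_le_nhds
      (U.map fun i => (g * α i - Real.pi * m i) / η i) (by
        rw [le_principal_iff]; exact hbound)
    have hτ' : Tendsto (fun i => (g * α i - Real.pi * m i) / η i) U (𝓝 τ) := hτ
    have key : ∀ ε : ℂ, (ε = 1 ∨ ε = -1) →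
        (∀ᶠ i in (U : Filter ι), exp (m i * (Real.pi * I)) = ε) →
        Tendsto (fun i => η i * logGen (z i) (η i - α i * I)) U
        (𝓝 (1 / 2 * Li₂ (ε * z₀ ^ g) / (g * (g - τ * I)))) := by
      intro ε hε hme
      have h := tendsto_mul_logGen_of_kernel (α := α) hη hz hzt
        (c := fun j => if g ∣ j + 1 then
          ε ^ ((j + 1) / g) / (2 * ((j + 1) / g : ℕ) * (g - τ * I)) else 0) (fun j => by
        split_ifs with hd
        · obtain ⟨l, hl⟩ := hd
          rcases l with _ | l
          · simp at hl
          · rw [hl, Nat.mul_div_cancel_left _ hg]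
            have := tendsto_kernel_of_dvd (α := α) hη hη0 hg hε hme hτ' j l hl
            push_cast
            exact this
        · refine tendsto_kernel_of_notMem hη ?_
          rwa [hmem'])
      rw [tsum_resonant z₀ ε (g - τ * I) hg] at h
      · exact h
      · intro j l hl
        rw [if_pos ⟨l + 1, hl⟩, hl, Nat.mul_div_cancel_left _ hg]
        push_cast
        rfl
      · intro j hd
        rw [if_neg hd]
    -- The ultrafilter decides the parity of `m`, and so the sign `ε`.
    rcases U.em (fun i => Even (m i)) with he | ho
    · refine ⟨g, 1, m, τ, hg, Or.inl ⟨rfl, ?_, he⟩, hτ', key 1 (Or.inl rfl) ?_⟩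
      -- If `g` and `m` were both even, halving would make `g / 2` resonant, against the choice of
      -- `g` as generator. Hence `ε = 1` occurs only for odd `g`.
      · by_contra hodd
        obtain ⟨k, hk⟩ := Nat.not_odd_iff_even.1 hodd
        have hkm : (k : ℤ) ∈ resonances U η α := by
          refine mem_resonances.2 ⟨C, ?_⟩
          filter_upwards [hm, he, hη] with i h1 h2 h3
          obtain ⟨n, hn⟩ := h2
          refine ⟨n, ?_⟩
          have e : ((g : ℤ) : ℝ) * α i - Real.pi * (m i : ℝ) =
              2 * (((k : ℤ) : ℝ) * α i - Real.pi * n) := by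
            rw [hn, hk]; push_cast; ring
          rw [e, abs_mul, abs_two] at h1
          linarith [abs_nonneg (((k : ℤ) : ℝ) * α i - Real.pi * n)]
        have hdk := (hmem' k).1 hkm
        have := Nat.le_of_dvd (by omega) hdk
        omega
      · filter_upwards [he] with i hi
        rw [exp_int_mul_pi_I, if_pos hi]
    · refine ⟨g, -1, m, τ, hg, Or.inr ⟨rfl, ?_⟩, hτ', key (-1) (Or.inr rfl) ?_⟩
      · filter_upwards [ho] with i hi
        exact Int.not_even_iff_odd.1 hi
      · filter_upwards [ho] with i hi
        rw [exp_int_mul_pi_I, if_neg hi]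

end Classification

/-! ### Amplitudes and dominance. -/

/-- The amplitude `(1 / g) * sqrt (Li₂ (ε * z ^ g) / 2)`. -/
def amp (ε : ℂ) (g : ℕ) (z : ℂ) : ℂ := 1 / g * (1 / 2 * Li₂ (ε * z ^ g)) ^ (1 / 2 : ℂ)

lemma cpow_half_sq (x : ℂ) : (x ^ (1 / 2 : ℂ)) ^ 2 = x := by
  rw [one_div]
  exact_mod_cast cpow_nat_inv_pow x two_ne_zero

lemma amp_sq (ε : ℂ) (g : ℕ) (z : ℂ) :
    amp ε g z ^ 2 = 1 / 2 * Li₂ (ε * z ^ g) / (g : ℂ) ^ 2 := by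
  rw [amp, mul_pow, cpow_half_sq]
  ring

lemma cpow_half_re_nonneg (x : ℂ) : 0 ≤ (x ^ (1 / 2 : ℂ)).re := by
  rcases eq_or_ne x 0 with rfl | hx
  · simp
  · rw [cpow_def_of_ne_zero hx, exp_re]
    refine mul_nonneg (Real.exp_pos _).le (Real.cos_nonneg_of_mem_Icc ?_)
    have e : (log x * (1 / 2)).im = arg x / 2 := by
      rw [show (1 / 2 : ℂ) = ((1 / 2 : ℝ) : ℂ) by push_cast; ring, im_mul_ofReal, log_im]
      ring
    rw [e]
    constructor <;> linarith [neg_pi_lt_arg x, arg_le_pi x]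

lemma amp_re_eq (ε : ℂ) (g : ℕ) (z : ℂ) :
    (amp ε g z).re = 1 / g * ((1 / 2 * Li₂ (ε * z ^ g)) ^ (1 / 2 : ℂ)).re := by
  rw [amp, show (1 / (g : ℂ)) = ((1 / g : ℝ) : ℂ) by push_cast; ring, re_ofReal_mul]

lemma amp_re_nonneg (ε : ℂ) (g : ℕ) (z : ℂ) : 0 ≤ (amp ε g z).re := by
  rw [amp_re_eq]
  exact mul_nonneg (by positivity) (cpow_half_re_nonneg _)

lemma mem_slitPlane_sq {s : ℂ} (hs : 0 < s.re) : s ^ 2 ∈ slitPlane := by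
  rw [mem_slitPlane_iff]
  by_contra! h
  obtain ⟨h1, h2⟩ := h
  simp only [sq, mul_re, mul_im] at h1 h2
  have h3 : s.im = 0 := by
    have : s.re * s.im = 0 := by linarith
    exact (mul_eq_zero.1 this).resolve_left hs.ne'
  rw [h3] at h1
  nlinarith

/-- The square of a number with positive real part avoids the branch cut, so a positive amplitude
never meets the discontinuity of the principal root. -/
lemma continuousAt_amp {ε : ℂ} (hε : ε = 1 ∨ ε = -1) {g : ℕ} (hg : 0 < g) {z₀ : ℂ}
    (hz : ‖z₀‖ < 1) (hre : 0 < (amp ε g z₀).re) : ContinuousAt (amp ε g) z₀ := by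
  have hn : ‖ε * z₀ ^ g‖ < 1 := by
    have : ‖ε‖ = 1 := by rcases hε with rfl | rfl <;> simp
    rw [norm_mul, this, one_mul, norm_pow]
    exact pow_lt_one₀ (norm_nonneg _) hz hg.ne'
  have h1 : ContinuousAt (fun z : ℂ => 1 / 2 * Li₂ (ε * z ^ g)) z₀ := by
    refine continuousAt_const.mul ?_
    exact ContinuousAt.comp (f := fun z : ℂ => ε * z ^ g) (continuousAt_Li₂ hn) (by fun_prop)
  refine continuousAt_const.mul (h1.cpow continuousAt_const ?_)
  have h2 : 0 < ((1 / 2 * Li₂ (ε * z₀ ^ g)) ^ (1 / 2 : ℂ)).re := by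
    rw [amp_re_eq] at hre
    exact pos_of_mul_pos_right hre (by positivity)
  rw [← cpow_half_sq (1 / 2 * Li₂ (ε * z₀ ^ g))]
  exact mem_slitPlane_sq h2

/-- The pairs `(ε, g)` that belong to a root of unity. -/
def Admissible (ε : ℂ) (g : ℕ) : Prop := (ε = 1 ∧ Odd g) ∨ ε = -1

lemma Admissible.eq_or {ε : ℂ} {g : ℕ} (h : Admissible ε g) : ε = 1 ∨ ε = -1 :=
  h.imp_left And.left

/-- At `z`, the amplitude of `(ε₀, g₀)` has the largest real part. -/
def Dominates (ε₀ : ℂ) (g₀ : ℕ) (z : ℂ) : Prop :=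
  ∀ (ε : ℂ) (g : ℕ), 0 < g → Admissible ε g → ¬ (ε = ε₀ ∧ g = g₀) →
    (amp ε g z).re < (amp ε₀ g₀ z).re

lemma Dominates.re_pos {ε₀ z : ℂ} {g₀ : ℕ} (h : Dominates ε₀ g₀ z) : 0 < (amp ε₀ g₀ z).re :=
  (amp_re_nonneg (-1) (g₀ + 1) z).trans_lt
    (h (-1) (g₀ + 1) (Nat.succ_pos _) (Or.inr rfl) (by simp))

lemma L_one_odd {g : ℕ} (hg : Odd g) (z : ℂ) : L 1 g z = amp 1 g z := by
  have h : Nat.gcd g 2 = 1 := Nat.coprime_two_right.2 hg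
  have he : exp (2 * Real.pi * I * ((1 : ℕ) : ℂ) / ((1 : ℕ) : ℂ)) = 1 := by
    simp [exp_two_pi_mul_I]
  rw [L, amp, h, he, Nat.div_one, mul_one, one_mul, Nat.cast_one]

lemma L_one_two_mul {g : ℕ} (hg : 0 < g) (z : ℂ) : L 1 (2 * g) z = amp (-1) g z := by
  have h : Nat.gcd (2 * g) 2 = 2 := Nat.gcd_eq_right (dvd_mul_right 2 g)
  have he : exp (2 * Real.pi * I * ((1 : ℕ) : ℂ) / ((2 : ℕ) : ℂ)) = -1 := by
    rw [← exp_pi_mul_I]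
    congr 1
    push_cast
    ring
  have hg' : (g : ℂ) ≠ 0 := by exact_mod_cast hg.ne'
  rw [L, amp, h, he, Nat.mul_div_cancel_left _ two_pos, mul_neg_one, neg_one_mul]
  congr 1
  push_cast
  field_simp

/-- Every amplitude of an admissible pair is some `L_{1,k}`, so `h = 1` suffices. The hypothesis
`hne` shows that no other pair falls in the class of the dominant one, so the phase inequality is
strict for all of them. -/
lemma dominates_of_phase {p q : ℕ} {ε₀ : ℂ} {g₀ : ℕ} (hL : ∀ z, L p q z = amp ε₀ g₀ z)
    (hne : ∀ (ε : ℂ) (g : ℕ), 0 < g → Admissible ε g → ¬ (ε = ε₀ ∧ g = g₀) →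
      ∃ z ∈ puncturedDisk, (amp ε g z).re ≠ (amp ε₀ g₀ z).re)
    {z : ℂ} (hz : z ∈ phase p q) : Dominates ε₀ g₀ z := by
  intro ε g hg hadm hneq
  obtain ⟨x, hx, hxne⟩ := hne ε g hg hadm hneq
  rcases hadm with ⟨rfl, hodd⟩ | rfl
  · rw [← hL, ← L_one_odd hodd]
    refine hz.2 1 g one_pos hg (Nat.coprime_one_left g) fun hsame => hxne ?_
    rw [← hL, ← L_one_odd hodd]
    exact hsame x hx
  · rw [← hL, ← L_one_two_mul hg]
    refine hz.2 1 (2 * g) one_pos (by omega) (Nat.coprime_one_left _) fun hsame => hxne ?_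
    rw [← hL, ← L_one_two_mul hg]
    exact hsame x hx

/-! ### Different amplitudes have different real parts somewhere. -/

section Separation

/-- The dilogarithm on the real axis. -/
def realLi₂ (t : ℝ) : ℝ := ∑' m : ℕ, t ^ (m + 1) / ((m : ℝ) + 1) ^ 2

lemma summable_realLi₂ {t : ℝ} (h0 : 0 ≤ t) (h1 : t < 1) :
    Summable (fun m : ℕ => t ^ (m + 1) / ((m : ℝ) + 1) ^ 2) := by
  refine Summable.of_nonneg_of_le (fun m => by positivity) (fun m => ?_)
    (summable_geometric_of_lt_one h0 h1)
  have h2 : (1 : ℝ) ≤ ((m : ℝ) + 1) ^ 2 :=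
    one_le_pow₀ (by linarith [(Nat.cast_nonneg m : (0 : ℝ) ≤ m)])
  exact (div_le_self (by positivity) h2).trans (pow_le_pow_of_le_one h0 h1.le (Nat.le_succ m))

lemma Li₂_ofReal (t : ℝ) : Li₂ t = (realLi₂ t : ℂ) := by
  rw [Li₂, realLi₂, ofReal_tsum]
  push_cast
  rfl

lemma norm_Li₂_term (z : ℂ) (m : ℕ) :
    ‖z ^ (m + 1) / ((m : ℂ) + 1) ^ 2‖ = ‖z‖ ^ (m + 1) / ((m : ℝ) + 1) ^ 2 := by
  rw [norm_div, norm_pow, norm_pow, norm_natCast_succ]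

lemma norm_Li₂_le {z : ℂ} (hz : ‖z‖ < 1) : ‖Li₂ z‖ ≤ realLi₂ ‖z‖ := by
  rw [Li₂]
  exact tsum_of_norm_bounded (summable_realLi₂ (norm_nonneg _) hz).hasSum
    fun m => (norm_Li₂_term z m).le

lemma realLi₂_mono {s t : ℝ} (h0 : 0 ≤ s) (h : s ≤ t) (h1 : t < 1) : realLi₂ s ≤ realLi₂ t :=
  (summable_realLi₂ h0 (h.trans_lt h1)).tsum_le_tsum (fun m => by gcongr)
    (summable_realLi₂ (h0.trans h) h1)

lemma realLi₂_pos {t : ℝ} (h0 : 0 < t) (h1 : t < 1) : 0 < realLi₂ t :=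
  (summable_realLi₂ h0.le h1).tsum_pos (fun m => by positivity) 0 (by simpa using h0)

lemma re_Li₂_neg_lt {t : ℝ} (h0 : 0 < t) (h1 : t < 1) : (Li₂ (-t)).re < realLi₂ t := by
  have hs : Summable (fun m : ℕ => (-(t : ℂ)) ^ (m + 1) / ((m : ℂ) + 1) ^ 2) := by
    refine Summable.of_norm ((summable_realLi₂ h0.le h1).congr fun m => ?_)
    rw [norm_Li₂_term, norm_neg, norm_real, Real.norm_eq_abs, abs_of_pos h0]
  rw [Li₂, re_tsum hs]
  refine Summable.tsum_lt_tsum (i := 0) (fun m => ?_) ?_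
    (hs.mapL reCLM) (summable_realLi₂ h0.le h1)
  · refine (re_le_norm _).trans ?_
    rw [norm_Li₂_term, norm_neg, norm_real, Real.norm_eq_abs, abs_of_pos h0]
  · simp
    linarith

lemma norm_amp_le {ε : ℂ} (hε : ε = 1 ∨ ε = -1) {g : ℕ} (hg : 0 < g) {z : ℂ} (hz : ‖z‖ < 1) :
    ‖amp ε g z‖ ≤ 1 / g * √(1 / 2 * realLi₂ (‖z‖ ^ g)) := by
  have hn : ‖ε * z ^ g‖ = ‖z‖ ^ g := by
    have : ‖ε‖ = 1 := by rcases hε with rfl | rfl <;> simp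
    rw [norm_mul, this, one_mul, norm_pow]
  have h1 : ‖(1 / 2 * Li₂ (ε * z ^ g)) ^ (1 / 2 : ℂ)‖ ^ 2 ≤ 1 / 2 * realLi₂ (‖z‖ ^ g) := by
    rw [← norm_pow, cpow_half_sq, norm_mul, ← hn]
    have : ‖(1 / 2 : ℂ)‖ = 1 / 2 := by simp
    rw [this]
    have := norm_Li₂_le (z := ε * z ^ g) (by
      rw [hn]; exact pow_lt_one₀ (norm_nonneg _) hz hg.ne')
    linarith
  rw [amp, norm_mul, norm_div, norm_one, norm_natCast]
  gcongr
  exact Real.le_sqrt_of_sq_le h1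

lemma amp_re_of_pos {ε : ℂ} {g : ℕ} {z : ℂ} {t : ℝ} (h : ε * z ^ g = t) (h0 : 0 < t)
    (h1 : t < 1) : (amp ε g z).re = 1 / g * √(1 / 2 * realLi₂ t) := by
  have hp := realLi₂_pos h0 h1
  have e : (1 / 2 * Li₂ (t : ℂ)) ^ (1 / 2 : ℂ) = ((√(1 / 2 * realLi₂ t) : ℝ) : ℂ) := by
    rw [Li₂_ofReal, Real.sqrt_eq_rpow, ofReal_cpow (by positivity)]
    push_cast
    rfl
  rw [amp_re_eq, h, e, ofReal_re]

/-- The right side is the value of `Re amp` at level `g₀` when `ε₀ z ^ g₀` is positive. A higher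
level loses by the factor `1 / g` and by monotonicity of the dilogarithm. -/
lemma re_lt_of_ratio {ε : ℂ} (hε : ε = 1 ∨ ε = -1) {g g₀ : ℕ} (hg₀ : 0 < g₀) (hlt : g₀ < g)
    {z : ℂ} (hz0 : z ≠ 0) (hz : ‖z‖ < 1) :
    (amp ε g z).re < 1 / g₀ * √(1 / 2 * realLi₂ (‖z‖ ^ g₀)) := by
  have hzp := norm_pos_iff.2 hz0
  have hpos := realLi₂_pos (pow_pos hzp g₀) (pow_lt_one₀ hzp.le hz hg₀.ne')
  have hmono := realLi₂_mono (pow_pos hzp g).le (pow_le_pow_of_le_one hzp.le hz.le hlt.le)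
    (pow_lt_one₀ hzp.le hz hg₀.ne')
  refine (re_le_norm _).trans_lt ((norm_amp_le hε (hg₀.trans hlt) hz).trans_lt ?_)
  have h1 : √(1 / 2 * realLi₂ (‖z‖ ^ g)) ≤ √(1 / 2 * realLi₂ (‖z‖ ^ g₀)) :=
    Real.sqrt_le_sqrt (by linarith)
  have h2 : 0 < √(1 / 2 * realLi₂ (‖z‖ ^ g₀)) := Real.sqrt_pos.2 (by positivity)
  have h3 : (1 : ℝ) / g < 1 / g₀ := by
    apply one_div_lt_one_div_of_lt
    · exact_mod_cast hg₀
    · exact_mod_cast hlt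
  have h4 : (0 : ℝ) ≤ 1 / g := by positivity
  nlinarith [mul_le_mul_of_nonneg_left h1 h4, mul_lt_mul_of_pos_right h3 h2]

lemma half_mem_puncturedDisk {x : ℂ} (hx : ‖x‖ = 1) : x / 2 ∈ puncturedDisk := by
  constructor
  · rw [norm_div, hx]; norm_num
  · intro h
    have : x = 0 := by simpa using h
    simp [this] at hx

lemma norm_half {x : ℂ} (hx : ‖x‖ = 1) : ‖x / 2‖ = 1 / 2 := by
  rw [norm_div, hx]; norm_num

/-- The test point `ε₀ / 2` makes the argument of the dilogarithm positive, so the amplitude of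
`(ε₀, 1)` is as large as its modulus allows. -/
lemma separate_one {ε₀ : ℂ} (hε₀ : ε₀ = 1 ∨ ε₀ = -1) {ε : ℂ} {g : ℕ} (hg : 0 < g)
    (hadm : Admissible ε g) (hne : ¬ (ε = ε₀ ∧ g = 1)) :
    ∃ z ∈ puncturedDisk, (amp ε g z).re ≠ (amp ε₀ 1 z).re := by
  have hn : ‖ε₀‖ = 1 := by rcases hε₀ with rfl | rfl <;> simp
  have hmem := half_mem_puncturedDisk hn
  have hval : ε₀ * (ε₀ / 2) ^ 1 = ((1 / 2 : ℝ) : ℂ) := by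
    rcases hε₀ with rfl | rfl <;> norm_num
  refine ⟨ε₀ / 2, hmem, ne_of_lt ?_⟩
  rw [amp_re_of_pos hval (by norm_num) (by norm_num)]
  rcases (Nat.succ_le_of_lt hg).eq_or_lt with h1 | h1
  · have hg1 : g = 1 := h1.symm
    subst hg1
    have hneg : ε * (ε₀ / 2) ^ 1 = -((1 / 2 : ℝ) : ℂ) := by
      have hεε : ε = -ε₀ := by
        have h2 : ε ≠ ε₀ := fun h => hne ⟨h, rfl⟩
        rcases hadm.eq_or with rfl | rfl <;> rcases hε₀ with rfl | rfl <;> simp_all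
      rw [hεε, neg_mul, hval]
    have hpos := realLi₂_pos (t := 1 / 2) (by norm_num) (by norm_num)
    rw [amp_re_eq, hneg]
    set c := (1 / 2 * Li₂ (-((1 / 2 : ℝ) : ℂ))) ^ (1 / 2 : ℂ) with hc
    have hsq : c ^ 2 = 1 / 2 * Li₂ (-((1 / 2 : ℝ) : ℂ)) := cpow_half_sq _
    have hnorm : ‖c‖ ^ 2 ≤ 1 / 2 * realLi₂ (1 / 2) := by
      rw [← norm_pow, hsq, norm_mul]
      have h3 : ‖-((1 / 2 : ℝ) : ℂ)‖ = 1 / 2 := by rw [norm_neg, norm_real]; norm_num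
      have h4 := norm_Li₂_le (z := -((1 / 2 : ℝ) : ℂ)) (by rw [h3]; norm_num)
      rw [h3] at h4
      have : ‖(1 / 2 : ℂ)‖ = 1 / 2 := by simp
      rw [this]
      linarith
    have hre : (c ^ 2).re < 1 / 2 * realLi₂ (1 / 2) := by
      rw [hsq, show (1 / 2 : ℂ) = ((1 / 2 : ℝ) : ℂ) by push_cast; ring, re_ofReal_mul]
      have := re_Li₂_neg_lt (t := 1 / 2) (by norm_num) (by norm_num)
      linarith
    -- `(Re c) ^ 2` is the mean of `‖c‖ ^ 2` and `Re (c ^ 2)`; the second is strictly below the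
    -- bound.
    have hre2 : c.re ^ 2 < 1 / 2 * realLi₂ (1 / 2) := by
      rw [← normSq_eq_norm_sq, normSq_apply] at hnorm
      simp only [sq, mul_re] at hre
      nlinarith
    refine mul_lt_mul_of_pos_left ?_ (by norm_num)
    exact Real.lt_sqrt_of_sq_lt hre2
  · have := re_lt_of_ratio hadm.eq_or one_pos h1 hmem.2 hmem.1
    rwa [pow_one, norm_half hn] at this

/-- Level one beats level two at `ε / 2`; level two beats all higher levels at `I / 2`, where `-z ^
2 = 1 / 4`. At level two itself, admissibility excludes `ε = 1`. -/
lemma separate_two {ε : ℂ} {g : ℕ} (hg : 0 < g)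
    (hadm : Admissible ε g) (hne : ¬ (ε = -1 ∧ g = 2)) :
    ∃ z ∈ puncturedDisk, (amp ε g z).re ≠ (amp (-1) 2 z).re := by
  rcases lt_trichotomy g 2 with h | rfl | h
  · have hg1 : g = 1 := by omega
    subst hg1
    have hn : ‖ε‖ = 1 := by rcases hadm.eq_or with rfl | rfl <;> simp
    have hmem := half_mem_puncturedDisk hn
    have hval : ε * (ε / 2) ^ 1 = ((1 / 2 : ℝ) : ℂ) := by
      rcases hadm.eq_or with rfl | rfl <;> norm_num
    refine ⟨ε / 2, hmem, ne_of_gt ?_⟩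
    rw [amp_re_of_pos hval (by norm_num) (by norm_num)]
    have := re_lt_of_ratio (ε := -1) (Or.inr rfl) one_pos (g := 2) (by norm_num) hmem.2 hmem.1
    rwa [pow_one, norm_half hn] at this
  · exfalso
    rcases hadm with ⟨-, h⟩ | h
    · exact absurd h (by decide)
    · exact hne ⟨h, rfl⟩
  · have hmem := half_mem_puncturedDisk norm_I
    have hval : -1 * (I / 2) ^ 2 = ((1 / 4 : ℝ) : ℂ) := by
      rw [div_pow, I_sq]; norm_num
    refine ⟨I / 2, hmem, ne_of_lt ?_⟩
    rw [amp_re_of_pos hval (by norm_num) (by norm_num)]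
    have := re_lt_of_ratio hadm.eq_or two_pos h hmem.2 hmem.1
    rw [norm_half norm_I] at this
    norm_num at this ⊢
    exact this

end Separation

lemma dominates_of_mem_phase_one_one {z : ℂ} (hz : z ∈ phase 1 1) : Dominates 1 1 z :=
  dominates_of_phase (L_one_odd odd_one) (fun _ _ hg => separate_one (Or.inl rfl) hg) hz

lemma dominates_of_mem_phase_one_two {z : ℂ} (hz : z ∈ phase 1 2) : Dominates (-1) 1 z :=
  dominates_of_phase (L_one_two_mul one_pos) (fun _ _ hg => separate_one (Or.inr rfl) hg) hz

lemma dominates_of_mem_phase_one_four {z : ℂ} (hz : z ∈ phase 1 4) : Dominates (-1) 2 z :=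
  dominates_of_phase (L_one_two_mul two_pos) (fun _ _ hg => separate_two hg) hz

lemma amp_neg (ε : ℂ) (g : ℕ) (z : ℂ) : amp ε g (-z) = amp (ε * (-1) ^ g) g z := by
  rw [amp, amp, neg_pow, mul_assoc]

lemma Dominates.neg {z : ℂ} (h : Dominates (-1) 1 z) : Dominates 1 1 (-z) := by
  intro ε g hg hadm hne
  rw [amp_neg, amp_neg, pow_one, one_mul]
  refine h _ g hg ?_ ?_
  · rcases hadm with ⟨rfl, hodd⟩ | rfl
    · right; rw [hodd.neg_one_pow, one_mul]
    · rcases Nat.even_or_odd g with he | ho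
      · right; rw [he.neg_one_pow, mul_one]
      · left; rw [ho.neg_one_pow]; exact ⟨by norm_num, ho⟩
  · rintro ⟨h1, rfl⟩
    refine hne ⟨?_, rfl⟩
    simpa using h1

/-! ### The estimate off the peaks. -/

/-- The deficit is a square, zero exactly at the offset `τ` with `Re c * τ + Im c = 0`, which is the
saddle. So on the circle a resonance contributes at most `(Re c) ^ 2`. -/
lemma re_sq_div (c : ℂ) (τ : ℝ) :
    (c ^ 2 / (1 - τ * I)).re = c.re ^ 2 - (c.re * τ + c.im) ^ 2 / (1 + τ ^ 2) := by
  have hpos : 0 < 1 + τ ^ 2 := by positivity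
  have h1 : (1 - τ * I : ℂ).re = 1 := by simp
  have h2 : (1 - τ * I : ℂ).im = -τ := by simp
  have h3 : normSq (1 - τ * I : ℂ) = 1 + τ ^ 2 := by rw [normSq_apply, h1, h2]; ring
  rw [div_re, h1, h2, h3]
  simp only [sq, mul_re, mul_im]
  rw [← sq τ]
  field_simp
  ring

lemma resonance_limit_eq (ε : ℂ) {g : ℕ} (hg : 0 < g) (z : ℂ) (τ : ℝ) :
    1 / 2 * Li₂ (ε * z ^ g) / (g * (g - τ * I)) =
      amp ε g z ^ 2 / (1 - (τ / g : ℝ) * I) := by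
  have hg' : (g : ℂ) ≠ 0 := by exact_mod_cast hg.ne'
  have h1 : (1 - (τ / g : ℝ) * I : ℂ) = (g - τ * I) / g := by
    push_cast; field_simp
  have h2 : (g - τ * I : ℂ) ≠ 0 := fun h => by
    have := congrArg re h
    simp at this
    omega
  rw [amp_sq, h1]
  field_simp

/-- The set `P` contains all `π m / g₀` in `[-π, π]` where `m` has the parity belonging to `ε₀`. -/
def IsPeakSet (ε₀ : ℂ) (g₀ : ℕ) (P : Set ℝ) : Prop :=
  ∀ α ∈ Set.Icc (-Real.pi) Real.pi, ∀ m : ℤ, (ε₀ = 1 → Even m) → (ε₀ = -1 → Odd m) →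
    |g₀ * α - Real.pi * m| < 1 → ∃ a ∈ P, Real.pi * m = g₀ * a

/-- The points of `[-π, π]` outside the windows around the saddle points. -/
def offPeak (P : Set ℝ) (A : ℂ → ℂ) (p : ℕ × ℂ) : Set ℝ :=
  {α | α ∈ Set.Icc (-Real.pi) Real.pi ∧
    ∀ a ∈ P, 1 ≤ |root4 p.1 ^ 2 * (α - a) + (A p.2).im|}

/-- Off the peaks, `η * log |G|` stays away from its maximum. -/
theorem exists_offPeak_gap {ε₀ : ℂ} {g₀ : ℕ} (hε₀ : Admissible ε₀ g₀) (hg₀ : 0 < g₀) {z₀ : ℂ}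
    (hz : ‖z₀‖ < 1) (hdom : Dominates ε₀ g₀ z₀) {P : Set ℝ} (hP : IsPeakSet ε₀ g₀ P) :
    ∃ δ > 0, ∀ᶠ p : ℕ × ℂ in atTop ×ˢ 𝓝 z₀, ∀ α ∈ offPeak P (amp ε₀ g₀) p,
      (amp ε₀ g₀ p.2).re / root4 p.1 ^ 2 *
        (logGen p.2 (((amp ε₀ g₀ p.2).re / root4 p.1 ^ 2 : ℝ) - α * I)).re ≤
      (amp ε₀ g₀ z₀).re ^ 2 - δ := by
  have hre := hdom.re_pos
  have hA := continuousAt_amp hε₀.eq_or hg₀ hz hre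
  set A := amp ε₀ g₀ with hAdef
  set T : Set ((ℕ × ℂ) × ℝ) := {q | q.2 ∈ offPeak P A q.1} with hT
  -- Uniformity in `α` is encoded by a filter on pairs that does not constrain `α` beyond lying off
  -- the peaks.
  suffices h : ∃ δ > 0, ∀ᶠ q : (ℕ × ℂ) × ℝ in comap Prod.fst (atTop ×ˢ 𝓝 z₀) ⊓ 𝓟 T,
      (A q.1.2).re / root4 q.1.1 ^ 2 *
        (logGen q.1.2 (((A q.1.2).re / root4 q.1.1 ^ 2 : ℝ) - q.2 * I)).re ≤
      (A z₀).re ^ 2 - δ by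
    obtain ⟨δ, hδ, h⟩ := h
    refine ⟨δ, hδ, ?_⟩
    rw [eventually_inf_principal, eventually_comap] at h
    filter_upwards [h] with p hp α hα
    exact hp (p, α) rfl hα
  refine exists_gap fun U hU => ?_
  have hU1 : Tendsto Prod.fst (U : Filter ((ℕ × ℂ) × ℝ)) (atTop ×ˢ 𝓝 z₀) :=
    tendsto_comap.mono_left (hU.trans inf_le_left)
  have hUT : ∀ᶠ q in (U : Filter ((ℕ × ℂ) × ℝ)), q ∈ T :=
    (hU.trans inf_le_right) (mem_principal_self T)
  have hzt : Tendsto (fun q : (ℕ × ℂ) × ℝ => q.1.2) U (𝓝 z₀) := tendsto_snd.comp hU1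
  have hAt : Tendsto (fun q : (ℕ × ℂ) × ℝ => A q.1.2) U (𝓝 (A z₀)) := hA.tendsto.comp hzt
  have hret := (continuous_re.tendsto _).comp hAt
  have himt := (continuous_im.tendsto _).comp hAt
  set η : (ℕ × ℂ) × ℝ → ℝ := fun q => (A q.1.2).re / root4 q.1.1 ^ 2 with hηdef
  have hη0 : Tendsto η U (𝓝 0) :=
    hret.div_atTop ((tendsto_pow_atTop two_ne_zero).comp
      (tendsto_root4.comp (tendsto_fst.comp hU1)))
  have hbd := hU1.eventually (eventually_re_bounds hA hre)
  have hη : ∀ᶠ q in (U : Filter ((ℕ × ℂ) × ℝ)), 0 < η q := by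
    filter_upwards [hbd] with q hq
    have := root4_pos hq.1
    have h2 : 0 < (A q.1.2).re := by linarith [hq.2.1]
    exact div_pos h2 (by positivity)
  have hreal : ∀ {v : ℂ}, Tendsto (fun q : (ℕ × ℂ) × ℝ =>
      (η q : ℂ) * logGen q.1.2 (η q - q.2 * I)) U (𝓝 v) →
      Tendsto (fun q : (ℕ × ℂ) × ℝ => η q * (logGen q.1.2 (η q - q.2 * I)).re) U (𝓝 v.re) := by
    intro v hv
    refine ((continuous_re.tendsto _).comp hv).congr fun q => ?_
    simp only [Function.comp, re_ofReal_mul]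
  rcases classification (α := fun q : (ℕ × ℂ) × ℝ => q.2) hη hη0 hz hzt with h | h
  · exact ⟨0, by positivity, zero_re ▸ hreal h⟩
  · obtain ⟨g, ε, m, τ, hg, hadm, hτ, hlim⟩ := h
    rw [resonance_limit_eq ε hg] at hlim
    refine ⟨_, ?_, hreal hlim⟩
    rw [re_sq_div]
    have hden : 0 < 1 + (τ / g) ^ 2 := by positivity
    have hadm' : Admissible ε g := by
      rcases hadm with ⟨h1, h2, -⟩ | ⟨h1, -⟩
      · exact Or.inl ⟨h1, h2⟩
      · exact Or.inr h1
    -- For the dominant pair the loss comes from the nonzero square, since `α` lies outside the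
    -- windows; for any other pair it comes from dominance.
    by_cases heq : ε = ε₀ ∧ g = g₀
    · obtain ⟨rfl, rfl⟩ := heq
      have hg' : (g : ℝ) ≠ 0 := by exact_mod_cast hg.ne'
      have hlim2 : Tendsto (fun q : (ℕ × ℂ) × ℝ => |(A q.1.2).re *
          ((g * q.2 - Real.pi * m q) / η q / g) + (A q.1.2).im|) U
          (𝓝 |(A z₀).re * (τ / g) + (A z₀).im|) :=
        ((hret.mul (hτ.div_const _)).add himt).abs
      have hsmall : Tendsto (fun q : (ℕ × ℂ) × ℝ => g * q.2 - Real.pi * m q) U (𝓝 0) := by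
        have := hτ.mul hη0
        rw [mul_zero] at this
        refine this.congr' ?_
        filter_upwards [hη] with q hq
        field_simp
      have hsmall' : ∀ᶠ q in (U : Filter ((ℕ × ℂ) × ℝ)), |g * q.2 - Real.pi * m q| < 1 :=
        hsmall.abs.eventually_lt_const (by simp)
      have hpar : ∀ᶠ q in (U : Filter ((ℕ × ℂ) × ℝ)),
          (ε = 1 → Even (m q)) ∧ (ε = -1 → Odd (m q)) := by
        rcases hadm with ⟨h1, -, h3⟩ | ⟨h1, h3⟩
        · filter_upwards [h3] with q hq
          refine ⟨fun _ => hq, fun h => ?_⟩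
          rw [h1] at h
          norm_num at h
        · filter_upwards [h3] with q hq
          refine ⟨fun h => ?_, fun _ => hq⟩
          rw [h1] at h
          norm_num at h
      -- With `π m = g a`, `Re A` times the rescaled offset is `√n (α - a)`, so the condition
      -- defining `offPeak` passes to the limit.
      have hge : 1 ≤ |(A z₀).re * (τ / g) + (A z₀).im| := by
        refine ge_of_tendsto hlim2 ?_
        filter_upwards [hsmall', hpar, hUT, hbd] with q h1 h2 h3 h4
        obtain ⟨a, ha, hma⟩ := hP q.2 h3.1 (m q) h2.1 h2.2 h1
        refine (h3.2 a ha).trans_eq ?_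
        have h5 := root4_pos h4.1
        have h6 : (A q.1.2).re ≠ 0 := by
          have := h4.2.1
          intro h
          linarith
        congr 2
        rw [hma, hηdef]
        simp only
        field_simp
      have hne : (A z₀).re * (τ / g) + (A z₀).im ≠ 0 := by
        intro h
        rw [h, abs_zero] at hge
        linarith
      have : 0 < ((A z₀).re * (τ / g) + (A z₀).im) ^ 2 / (1 + (τ / g) ^ 2) := by positivity
      linarith
    · have h1 := hdom ε g hg hadm' heq
      have h2 := amp_re_nonneg ε g z₀
      have h3 : 0 ≤ ((amp ε g z₀).re * (τ / g) + (amp ε g z₀).im) ^ 2 / (1 + (τ / g) ^ 2) := by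
        positivity
      have h4 : (amp ε g z₀).re ^ 2 < (A z₀).re ^ 2 := by
        exact pow_lt_pow_left₀ h1 h2 two_ne_zero
      linarith

/-- Off the peaks the integrand is exponentially smaller than the main term. -/
theorem exists_offPeak_bound {ε₀ : ℂ} {g₀ : ℕ} (hε₀ : Admissible ε₀ g₀) (hg₀ : 0 < g₀) {z₀ : ℂ}
    (hz : ‖z₀‖ < 1) (hdom : Dominates ε₀ g₀ z₀) {P : Set ℝ} (hP : IsPeakSet ε₀ g₀ P) :
    ∃ δ > 0, ∀ᶠ p : ℕ × ℂ in atTop ×ˢ 𝓝 z₀, ∀ α ∈ offPeak P (amp ε₀ g₀) p,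
      ‖exp (-(2 * amp ε₀ g₀ p.2 * (root4 p.1 : ℂ) ^ 2)) *
        cauchyIntegrand p.1 p.2 ((amp ε₀ g₀ p.2).re / root4 p.1 ^ 2) α‖ ≤
      Real.exp (-(δ * root4 p.1 ^ 2)) := by
  obtain ⟨δ, hδ, hgap⟩ := exists_offPeak_gap hε₀ hg₀ hz hdom hP
  have hre := hdom.re_pos
  have hA := continuousAt_amp hε₀.eq_or hg₀ hz hre
  set A := amp ε₀ g₀ with hAdef
  have hsq : ∀ᶠ p : ℕ × ℂ in atTop ×ˢ 𝓝 z₀, (A z₀).re ^ 2 - δ / 2 < (A p.2).re ^ 2 := by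
    have h : Tendsto (fun z => (A z).re ^ 2) (𝓝 z₀) (𝓝 ((A z₀).re ^ 2)) :=
      ((continuous_re.tendsto _).comp hA.tendsto).pow 2
    exact tendsto_snd.eventually (h.eventually_const_lt (by linarith))
  -- Half of `δ` pays for replacing `A z₀` by `A p.2`; dividing by `η = Re A / √n` with `Re A ≤ ‖A
  -- z₀‖ + 1` gives the rate in `√n`.
  refine ⟨δ / 2 / (‖A z₀‖ + 1), by positivity, ?_⟩
  filter_upwards [hgap, hsq, eventually_re_bounds hA hre] with p h1 h2 h3 α hα
  have h4 := h1 α hα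
  have hr := root4_pos h3.1
  have ha : 0 < (A p.2).re := by linarith [h3.2.1]
  have hle : (A p.2).re ≤ ‖A z₀‖ + 1 := (re_le_norm _).trans h3.2.2.le
  set Λ := (logGen p.2 (((A p.2).re / root4 p.1 ^ 2 : ℝ) - α * I)).re with hΛ
  rw [cauchyIntegrand, norm_mul, norm_mul, norm_exp, norm_exp, norm_exp, ← Real.exp_add,
    ← Real.exp_add, ← hΛ]
  refine Real.exp_le_exp.2 ?_
  have e1 : (-(2 * A p.2 * (root4 p.1 : ℂ) ^ 2)).re = -(2 * (A p.2).re * root4 p.1 ^ 2) := by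
    rw [show -(2 * A p.2 * (root4 p.1 : ℂ) ^ 2) = ((-(2 * root4 p.1 ^ 2) : ℝ) : ℂ) * A p.2 by
      push_cast; ring, re_ofReal_mul]
    ring
  have e2 : ((p.1 : ℂ) * ((((A p.2).re / root4 p.1 ^ 2 : ℝ) : ℂ) - α * I)).re =
      (A p.2).re * root4 p.1 ^ 2 := by
    rw [show (p.1 : ℂ) = ((p.1 : ℝ) : ℂ) by simp, re_ofReal_mul, ← root4_pow_four p.1]
    have e3 : ((((A p.2).re / root4 p.1 ^ 2 : ℝ) : ℂ) - α * I).re =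
        (A p.2).re / root4 p.1 ^ 2 := by simp [-ofReal_div]
    rw [e3]
    field_simp
  rw [e1, e2]
  have h5 : Λ ≤ ((A p.2).re ^ 2 - δ / 2) * root4 p.1 ^ 2 / (A p.2).re := by
    rw [le_div_iff₀ ha]
    have h6 : (A p.2).re / root4 p.1 ^ 2 * Λ ≤ (A p.2).re ^ 2 - δ / 2 := by linarith
    rw [div_mul_eq_mul_div, div_le_iff₀ (by positivity)] at h6
    linarith
  have h7 : δ / 2 / (‖A z₀‖ + 1) ≤ δ / 2 / (A p.2).re := by gcongr
  have h8 : ((A p.2).re ^ 2 - δ / 2) * root4 p.1 ^ 2 / (A p.2).re =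
      (A p.2).re * root4 p.1 ^ 2 - δ / 2 / (A p.2).re * root4 p.1 ^ 2 := by
    field_simp
  have h9 := mul_le_mul_of_nonneg_right h7 (by positivity : 0 ≤ root4 p.1 ^ 2)
  linarith

/-- Integrals over intervals off the peaks are negligible. -/
theorem tendsto_tail {ε₀ : ℂ} {g₀ : ℕ} (hε₀ : Admissible ε₀ g₀) (hg₀ : 0 < g₀) {z₀ : ℂ}
    (hz : ‖z₀‖ < 1) (hdom : Dominates ε₀ g₀ z₀) {P : Set ℝ} (hP : IsPeakSet ε₀ g₀ P)
    {x y : ℕ × ℂ → ℝ} (hxy : ∀ᶠ p in atTop ×ˢ 𝓝 z₀, x p ≤ y p)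
    (hoff : ∀ᶠ p in atTop ×ˢ 𝓝 z₀, Set.Icc (x p) (y p) ⊆ offPeak P (amp ε₀ g₀) p) :
    Tendsto (fun p : ℕ × ℂ => (root4 p.1 : ℂ) ^ 3 *
      exp (-(2 * amp ε₀ g₀ p.2 * (root4 p.1 : ℂ) ^ 2)) *
      ∫ α in (x p)..(y p), cauchyIntegrand p.1 p.2 ((amp ε₀ g₀ p.2).re / root4 p.1 ^ 2) α)
      (atTop ×ˢ 𝓝 z₀) (𝓝 0) := by
  obtain ⟨δ, hδ, hb⟩ := exists_offPeak_bound hε₀ hg₀ hz hdom hP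
  have hlim : Tendsto (fun r : ℝ => r ^ 3 * Real.exp (-(δ * r ^ 2)) * (2 * Real.pi))
      atTop (𝓝 0) := by
    have h1 : Tendsto (fun r : ℝ => r ^ 3 * Real.exp (-r)) atTop (𝓝 0) :=
      Real.tendsto_pow_mul_exp_neg_atTop_nhds_zero 3
    have h2 : Tendsto (fun r : ℝ => r ^ 3 * Real.exp (-(δ * r ^ 2))) atTop (𝓝 0) := by
      refine squeeze_zero' ?_ ?_ h1
      · filter_upwards [eventually_ge_atTop 0] with r hr
        positivity
      · filter_upwards [eventually_ge_atTop (1 / δ), eventually_ge_atTop 0] with r hr hr0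
        rw [div_le_iff₀ hδ] at hr
        have : r ≤ δ * r ^ 2 := by nlinarith
        gcongr
    simpa using h2.mul_const (2 * Real.pi)
  refine squeeze_zero_norm' ?_ (hlim.comp (tendsto_root4.comp tendsto_fst))
  filter_upwards [hxy, hoff, hb, tendsto_fst.eventually (eventually_gt_atTop 0)]
    with p h1 h2 h3 h4
  have hr := root4_pos h4
  rw [mul_assoc, norm_mul, ← intervalIntegral.integral_const_mul, norm_pow, norm_real,
    Real.norm_eq_abs, abs_of_pos hr]
  have hint := intervalIntegral.norm_integral_le_of_norm_le_const (a := x p) (b := y p)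
    (C := Real.exp (-(δ * root4 p.1 ^ 2))) (f := fun α =>
      exp (-(2 * amp ε₀ g₀ p.2 * (root4 p.1 : ℂ) ^ 2)) *
        cauchyIntegrand p.1 p.2 ((amp ε₀ g₀ p.2).re / root4 p.1 ^ 2) α) (fun α hα => by
      rw [Set.uIoc_of_le h1] at hα
      exact h3 α (h2 (Set.Ioc_subset_Icc_self hα)))
  have hlen : |y p - x p| ≤ 2 * Real.pi := by
    have hx := (h2 (Set.left_mem_Icc.2 h1)).1
    have hy := (h2 (Set.right_mem_Icc.2 h1)).1
    rw [abs_of_nonneg (by linarith)]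
    linarith [hx.1, hy.2]
  have hfin := mul_le_mul_of_nonneg_left
    (hint.trans (mul_le_mul_of_nonneg_left hlen (Real.exp_pos (-(δ * root4 p.1 ^ 2))).le))
    (pow_nonneg hr.le 3)
  rw [← mul_assoc (root4 p.1 ^ 3)] at hfin
  exact hfin

/-! ### The main term and its normalisation. -/

lemma abs_arg_cpow_half_lt {x : ℂ} (hx : 0 < x.re) :
    |arg (x ^ (1 / 2 : ℂ))| < Real.pi / 4 := by
  have hx0 : x ≠ 0 := fun h => by simp [h] at hx
  have harg := abs_lt.1 (abs_arg_lt_pi_div_two_iff.2 (Or.inl hx))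
  have him : (log x * (1 / 2)).im = arg x / 2 := by
    rw [show (1 / 2 : ℂ) = ((1 / 2 : ℝ) : ℂ) by push_cast; ring, im_mul_ofReal, log_im]
    ring
  have hpi := Real.pi_pos
  rw [cpow_def_of_ne_zero hx0, ← log_im, log_exp (by rw [him]; linarith [harg.1])
    (by rw [him]; linarith [harg.2]), him, abs_lt]
  constructor <;> linarith [harg.1, harg.2]

/-- The saddle point approximation, in terms of the amplitude `a`. -/
def saddleTerm (n : ℕ) (a : ℂ) : ℂ :=
  (a ^ 2 / (16 * (Real.pi : ℂ) ^ 2 * (n : ℂ) ^ 3)) ^ (1 / 4 : ℂ) *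
    exp ((4 * (n : ℂ) * a ^ 2) ^ (1 / 2 : ℂ))

lemma natCast_eq_root4 (n : ℕ) : (n : ℂ) = (root4 n : ℂ) ^ 4 := by
  exact_mod_cast congrArg (fun x : ℝ => (x : ℂ)) (root4_pow_four n).symm

/-- The factor that normalises the Cauchy integral. -/
def normaliser (n : ℕ) (a : ℂ) : ℂ := (root4 n : ℂ) ^ 3 * exp (-(2 * a * (root4 n : ℂ) ^ 2))

lemma normaliser_ne_zero {n : ℕ} (hn : 0 < n) (a : ℂ) : normaliser n a ≠ 0 := by
  have : (root4 n : ℂ) ≠ 0 := by exact_mod_cast (root4_pos hn).ne'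
  exact mul_ne_zero (pow_ne_zero _ this) (exp_ne_zero _)

/-- The principal branches are the right ones because `Re a > 0`: `sqrt (4 n a ^ 2) = 2 a √n`, and
`s = (π a) ^ (1/2)` has argument below `π / 4` in modulus, so it is the principal fourth root of `s
^ 4`. -/
lemma normaliser_mul_saddleTerm {n : ℕ} (hn : 0 < n) {a : ℂ} (ha : 0 < a.re) :
    2 * Real.pi * normaliser n a * saddleTerm n a = (Real.pi * a) ^ (1 / 2 : ℂ) := by
  have hr := root4_pos hn
  have hr' : (root4 n : ℂ) ≠ 0 := by exact_mod_cast hr.ne'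
  have hpi : (Real.pi : ℂ) ≠ 0 := by exact_mod_cast Real.pi_ne_zero
  have h1 : (4 * (n : ℂ) * a ^ 2) ^ (1 / 2 : ℂ) = 2 * a * (root4 n : ℂ) ^ 2 := by
    have e : 4 * (n : ℂ) * a ^ 2 = (((2 * root4 n ^ 2 : ℝ) : ℂ) * a) ^ 2 := by
      rw [natCast_eq_root4]; push_cast; ring
    rw [e, one_div, sq_cpow_two_inv (by rw [re_ofReal_mul]; positivity)]
    push_cast
    ring
  set s := (Real.pi * a) ^ (1 / 2 : ℂ) with hs
  have hs2 : s ^ 2 = Real.pi * a := cpow_half_sq _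
  have harg : |arg s| < Real.pi / 4 :=
    abs_arg_cpow_half_lt (by rw [re_ofReal_mul]; exact mul_pos Real.pi_pos ha)
  have h2 : (a ^ 2 / (16 * (Real.pi : ℂ) ^ 2 * (n : ℂ) ^ 3)) ^ (1 / 4 : ℂ) =
      ((1 / (2 * Real.pi * root4 n ^ 3) : ℝ) : ℂ) * s := by
    have e : a ^ 2 / (16 * (Real.pi : ℂ) ^ 2 * (n : ℂ) ^ 3) =
        (((1 / (2 * Real.pi * root4 n ^ 3) : ℝ) : ℂ) * s) ^ 4 := by
      rw [mul_pow, show s ^ 4 = (s ^ 2) ^ 2 by ring, hs2, natCast_eq_root4]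
      push_cast
      field_simp
      norm_num
    have hy : arg (((1 / (2 * Real.pi * root4 n ^ 3) : ℝ) : ℂ) * s) = arg s :=
      arg_real_mul s (by positivity)
    have := pow_cpow_nat_inv (x := ((1 / (2 * Real.pi * root4 n ^ 3) : ℝ) : ℂ) * s) (n := 4)
      (by norm_num) (by rw [hy]; exact_mod_cast (abs_lt.1 harg).1)
      (by rw [hy]; exact_mod_cast (abs_lt.1 harg).2.le)
    rw [e, show (1 / 4 : ℂ) = ((4 : ℕ) : ℂ)⁻¹ by norm_num]
    exact this
  rw [saddleTerm, normaliser, h1, h2, Complex.exp_neg]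
  have := exp_ne_zero (2 * a * (root4 n : ℂ) ^ 2)
  push_cast
  field_simp

section Windows

variable {z₀ : ℂ} {A : ℂ → ℂ}

lemma eventually_window_small (hA : ContinuousAt A z₀) (hre : 0 < (A z₀).re) :
    ∀ᶠ p : ℕ × ℂ in atTop ×ˢ 𝓝 z₀,
      |(A p.2).im / root4 p.1 ^ 2| + 1 / root4 p.1 ^ 2 < 1 := by
  have h1 : Tendsto (fun p : ℕ × ℂ => root4 p.1 ^ 2) (atTop ×ˢ 𝓝 z₀) atTop :=
    (tendsto_pow_atTop two_ne_zero).comp (tendsto_root4.comp tendsto_fst)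
  filter_upwards [eventually_re_bounds hA hre, h1.eventually (eventually_gt_atTop (‖A z₀‖ + 2))]
    with p hp h2
  have h3 : 0 < root4 p.1 ^ 2 := by positivity [root4_pos hp.1]
  rw [abs_div, abs_of_pos h3, ← add_div, div_lt_one h3]
  linarith [abs_im_le_norm (A p.2), hp.2.2]

lemma one_le_abs_of_le {r b a α : ℝ} (hr : 0 < r) (h : α ≤ a - b / r ^ 2 - 1 / r ^ 2) :
    1 ≤ |r ^ 2 * (α - a) + b| := by
  have h1 : r ^ 2 * α ≤ r ^ 2 * (a - b / r ^ 2 - 1 / r ^ 2) := by gcongr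
  have h2 : r ^ 2 * (a - b / r ^ 2 - 1 / r ^ 2) = r ^ 2 * a - b - 1 := by field_simp
  rw [le_abs]
  right
  linarith

lemma one_le_abs_of_ge {r b a α : ℝ} (hr : 0 < r) (h : a - b / r ^ 2 + 1 / r ^ 2 ≤ α) :
    1 ≤ |r ^ 2 * (α - a) + b| := by
  have h1 : r ^ 2 * (a - b / r ^ 2 + 1 / r ^ 2) ≤ r ^ 2 * α := by gcongr
  have h2 : r ^ 2 * (a - b / r ^ 2 + 1 / r ^ 2) = r ^ 2 * a - b + 1 := by field_simp
  rw [le_abs]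
  left
  linarith

end Windows

lemma integral_split {f : ℝ → ℂ} (hf : Continuous f) (a b c d : ℝ) :
    ∫ x in a..d, f x = (∫ x in a..b, f x) + (∫ x in b..c, f x) + ∫ x in c..d, f x := by
  rw [intervalIntegral.integral_add_adjacent_intervals (hf.intervalIntegrable _ _)
    (hf.intervalIntegrable _ _), intervalIntegral.integral_add_adjacent_intervals
    (hf.intervalIntegrable _ _) (hf.intervalIntegrable _ _)]

/-! ### The dominant singularities `q = 1` and `q = -1`. -/

lemma isPeakSet_one : IsPeakSet 1 1 {0} := by
  intro α hα m hm _ h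
  refine ⟨0, rfl, ?_⟩
  have hpi := Real.pi_gt_three
  rw [Nat.cast_one, one_mul, abs_lt] at h
  obtain ⟨k, hk⟩ := hm rfl
  have hk0 : k = 0 := by
    have hm' : (m : ℝ) = 2 * k := by rw [hk]; push_cast; ring
    rw [hm'] at h
    have h1 : (k : ℝ) < 1 := by
      by_contra! hge
      nlinarith [h.1, hα.2]
    have h2 : (-1 : ℝ) < k := by
      by_contra! hge
      nlinarith [h.2, hα.1]
    have h3 : k < 1 := by exact_mod_cast h1
    have h4 : -1 < k := by exact_mod_cast h2
    omega
  simp [hk, hk0]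

lemma isPeakSet_two : IsPeakSet (-1) 2 {Real.pi / 2, -(Real.pi / 2)} := by
  intro α hα m _ hm h
  have hpi := Real.pi_gt_three
  rw [abs_lt] at h
  push_cast at h
  obtain ⟨k, hk⟩ := hm rfl
  have hm' : (m : ℝ) = 2 * k + 1 := by rw [hk]; push_cast; ring
  rw [hm'] at h ⊢
  have h1 : (k : ℝ) < 1 := by
    by_contra! hge
    nlinarith [h.1, hα.2]
  have h2 : (-2 : ℝ) < k := by
    by_contra! hge
    nlinarith [h.2, hα.1]
  have h3 : k < 1 := by exact_mod_cast h1
  have h4 : -2 < k := by exact_mod_cast h2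
  have h5 : k = 0 ∨ k = -1 := by omega
  rcases h5 with rfl | rfl
  · refine ⟨Real.pi / 2, by simp, ?_⟩
    push_cast
    ring
  · refine ⟨-(Real.pi / 2), by simp, ?_⟩
    push_cast
    ring

/-- The normalised coefficient converges when the dominant singularity is `q = 1`. -/
theorem tendsto_normalised_one {z₀ : ℂ} (hz : ‖z₀‖ < 1) (hdom : Dominates 1 1 z₀) :
    Tendsto (fun p : ℕ × ℂ => 2 * Real.pi * normaliser p.1 (amp 1 1 p.2) * Q p.1 p.2)
      (atTop ×ˢ 𝓝 z₀) (𝓝 ((Real.pi * amp 1 1 z₀) ^ (1 / 2 : ℂ))) := by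
  have hadm : Admissible 1 1 := Or.inl ⟨rfl, odd_one⟩
  have hre := hdom.re_pos
  have hA := continuousAt_amp hadm.eq_or one_pos hz hre
  have hwin := tendsto_window hz hA hre (α₀ := 0) (e₀ := 0) (fun K hK => by
    refine (tendsto_logGen_sub_at_one hz hK).congr fun p => ?_
    rw [amp_sq]
    simp)
  have hsmall := eventually_window_small hA hre
  have hbd := eventually_re_bounds hA hre
  have hlt : ∀ᶠ p : ℕ × ℂ in atTop ×ˢ 𝓝 z₀, ‖p.2‖ < 1 :=
    tendsto_snd.norm.eventually_lt_const hz
  set A := amp 1 1 with hAdef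
  have hpi := Real.pi_gt_three
  have ht1 := tendsto_tail hadm one_pos hz hdom isPeakSet_one (x := fun _ => -Real.pi)
    (y := fun p => 0 - (A p.2).im / root4 p.1 ^ 2 - 1 / root4 p.1 ^ 2)
    (by
      filter_upwards [hsmall] with p hp
      linarith [le_abs_self ((A p.2).im / root4 p.1 ^ 2)])
    (by
      filter_upwards [hsmall, hbd] with p hp hq α hα
      have hr := root4_pos hq.1
      have h0 : 0 < 1 / root4 p.1 ^ 2 := by positivity
      refine ⟨⟨hα.1, ?_⟩, ?_⟩
      · linarith [hα.2, neg_abs_le ((A p.2).im / root4 p.1 ^ 2)]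
      · rintro a rfl
        exact one_le_abs_of_le hr hα.2)
  have ht2 := tendsto_tail hadm one_pos hz hdom isPeakSet_one (y := fun _ => Real.pi)
    (x := fun p => 0 - (A p.2).im / root4 p.1 ^ 2 + 1 / root4 p.1 ^ 2)
    (by
      filter_upwards [hsmall] with p hp
      linarith [neg_abs_le ((A p.2).im / root4 p.1 ^ 2)])
    (by
      filter_upwards [hsmall, hbd] with p hp hq α hα
      have hr := root4_pos hq.1
      have h0 : 0 < 1 / root4 p.1 ^ 2 := by positivity
      refine ⟨⟨?_, hα.2⟩, ?_⟩
      · linarith [hα.1, le_abs_self ((A p.2).im / root4 p.1 ^ 2)]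
      · rintro a rfl
        exact one_le_abs_of_ge hr hα.1)
  rw [← hAdef] at ht1 ht2
  -- The circle is one window and two negligible arcs.
  have hsum := (ht1.add hwin).add ht2
  rw [Complex.exp_zero, mul_one, zero_add, add_zero] at hsum
  refine hsum.congr' ?_
  filter_upwards [hbd, hlt] with p hp hz1
  have hr := root4_pos hp.1
  have ha : 0 < (A p.2).re := by linarith [hp.2.1]
  have hη : 0 < (A p.2).re / root4 p.1 ^ 2 := by positivity
  have hc := continuous_cauchyIntegrand p.1 hz1 hη
  have hQ := integral_exp_logGen hz1 hη p.1
  change ∫ α in (-Real.pi)..Real.pi,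
    cauchyIntegrand p.1 p.2 ((A p.2).re / root4 p.1 ^ 2) α = _ at hQ
  rw [show 2 * Real.pi * normaliser p.1 (A p.2) * Q p.1 p.2 =
    normaliser p.1 (A p.2) * (2 * Real.pi * Q p.1 p.2) by ring, ← hQ, normaliser,
    integral_split hc (-Real.pi) (0 - (A p.2).im / root4 p.1 ^ 2 - 1 / root4 p.1 ^ 2)
      (0 - (A p.2).im / root4 p.1 ^ 2 + 1 / root4 p.1 ^ 2) Real.pi]
  simp only [ofReal_zero, zero_mul, mul_zero, Complex.exp_zero, mul_one]
  ring

/-- The asymptotic formula near a point where the singularity `q = 1` dominates. -/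
theorem tendsto_ratio_one {z₀ : ℂ} (hz : ‖z₀‖ < 1) (hdom : Dominates 1 1 z₀) :
    Tendsto (fun p : ℕ × ℂ => Q p.1 p.2 /
      ((Li₂ p.2 / (32 * (Real.pi : ℂ) ^ 2 * (p.1 : ℂ) ^ 3)) ^ (1 / 4 : ℂ) *
        exp ((2 * (p.1 : ℂ) * Li₂ p.2) ^ (1 / 2 : ℂ)))) (atTop ×ˢ 𝓝 z₀) (𝓝 1) := by
  have hadm : Admissible 1 1 := Or.inl ⟨rfl, odd_one⟩
  have hre := hdom.re_pos
  have hA := continuousAt_amp hadm.eq_or one_pos hz hre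
  have hnum := tendsto_normalised_one hz hdom
  have hpos : 0 < (Real.pi * amp 1 1 z₀ : ℂ).re := by
    rw [re_ofReal_mul]; exact mul_pos Real.pi_pos hre
  have hden : Tendsto (fun p : ℕ × ℂ => (Real.pi * amp 1 1 p.2 : ℂ) ^ (1 / 2 : ℂ))
      (atTop ×ˢ 𝓝 z₀) (𝓝 ((Real.pi * amp 1 1 z₀) ^ (1 / 2 : ℂ))) :=
    (((continuousAt_const.mul hA).cpow continuousAt_const
      (mem_slitPlane_iff.2 (Or.inl hpos))).tendsto).comp tendsto_snd
  have hne : (Real.pi * amp 1 1 z₀ : ℂ) ^ (1 / 2 : ℂ) ≠ 0 := by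
    have h0 : (Real.pi * amp 1 1 z₀ : ℂ) ≠ 0 := fun h => by simp [h] at hpos
    simp [cpow_eq_zero_iff, h0]
  have hq := hnum.div hden hne
  rw [div_self hne] at hq
  refine hq.congr' ?_
  filter_upwards [eventually_re_bounds hA hre] with p hp
  have ha : 0 < (amp 1 1 p.2).re := by linarith [hp.2.1]
  have hLi : Li₂ p.2 = 2 * amp 1 1 p.2 ^ 2 := by rw [amp_sq]; simp
  have hb : (Li₂ p.2 / (32 * (Real.pi : ℂ) ^ 2 * (p.1 : ℂ) ^ 3)) ^ (1 / 4 : ℂ) *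
      exp ((2 * (p.1 : ℂ) * Li₂ p.2) ^ (1 / 2 : ℂ)) = saddleTerm p.1 (amp 1 1 p.2) := by
    rw [saddleTerm, hLi]
    congr 2
    · rw [show (32 : ℂ) * (Real.pi : ℂ) ^ 2 * (p.1 : ℂ) ^ 3 =
        2 * (16 * (Real.pi : ℂ) ^ 2 * (p.1 : ℂ) ^ 3) by ring,
        mul_div_mul_left _ _ (two_ne_zero)]
    · congr 1
      ring
  rw [Pi.div_apply, hb, ← normaliser_mul_saddleTerm hp.1 ha]
  refine mul_div_mul_left _ _ ?_
  have hpi : (Real.pi : ℂ) ≠ 0 := by exact_mod_cast Real.pi_ne_zero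
  exact mul_ne_zero (mul_ne_zero two_ne_zero hpi) (normaliser_ne_zero hp.1 _)

/-- A sum of odd parts has the parity of the number of parts. -/
lemma Q_neg (n : ℕ) (z : ℂ) : Q n (-z) = (-1) ^ n * Q n z := by
  rw [Q, Q, Finset.mul_sum]
  refine Finset.sum_congr rfl fun p hp => ?_
  rw [neg_pow]
  congr 1
  have hodd : ∀ i ∈ p.parts, Odd i := by
    intro i hi
    rw [Nat.Partition.odds, Nat.Partition.restricted, Finset.mem_filter] at hp
    exact Nat.not_even_iff_odd.1 (hp.2 i hi)
  have key : ∀ s : Multiset ℕ, (∀ i ∈ s, Odd i) → (-1 : ℂ) ^ Multiset.card s = (-1) ^ s.sum := by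
    intro s
    induction s using Multiset.induction_on with
    | empty => simp
    | cons a s ih =>
      intro h
      rw [Multiset.card_cons, Multiset.sum_cons, pow_succ, pow_add,
        ih fun i hi => h i (Multiset.mem_cons_of_mem hi),
        (h a (Multiset.mem_cons_self a s)).neg_one_pow, mul_comm]
  rw [key _ hodd, p.parts_sum]

/-- The asymptotic formula near a point where the singularity `q = -1` dominates. -/
theorem tendsto_ratio_neg_one {z₀ : ℂ} (hz : ‖z₀‖ < 1) (hdom : Dominates (-1) 1 z₀) :
    Tendsto (fun p : ℕ × ℂ => Q p.1 p.2 / ((-1 : ℂ) ^ p.1 *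
      (Li₂ (-p.2) / (32 * (Real.pi : ℂ) ^ 2 * (p.1 : ℂ) ^ 3)) ^ (1 / 4 : ℂ) *
        exp ((2 * (p.1 : ℂ) * Li₂ (-p.2)) ^ (1 / 2 : ℂ)))) (atTop ×ˢ 𝓝 z₀) (𝓝 1) := by
  have h := tendsto_ratio_one (z₀ := -z₀) (by rwa [norm_neg]) hdom.neg
  have hneg : Tendsto (fun p : ℕ × ℂ => (p.1, -p.2)) (atTop ×ˢ 𝓝 z₀) (atTop ×ˢ 𝓝 (-z₀)) :=
    tendsto_fst.prodMk tendsto_snd.neg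
  refine (h.comp hneg).congr fun p => ?_
  have hs : (-1 : ℂ) ^ p.1 * (-1) ^ p.1 = 1 := by rw [← mul_pow]; simp
  have hn : (-1 : ℂ) ^ p.1 ≠ 0 := pow_ne_zero _ (by norm_num)
  simp only [Function.comp]
  rw [Q_neg, mul_assoc ((-1 : ℂ) ^ p.1), ← mul_div_mul_left _ _ hn, ← mul_assoc, hs, one_mul]

/-! ### The dominant pair `q = ±i`. -/

lemma one_add_re_pos {x : ℂ} (hx : ‖x‖ < 1) : 0 < (1 + x).re := by
  rw [add_re, one_re]
  linarith [neg_abs_le x.re, abs_re_le_norm x]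

/-- Both `1 + x` and `1 - x` lie in the right half plane, so the difference of their arguments stays
within `(-π, π)` and the principal logarithm splits. -/
lemma cpow_quarter_eq {x : ℂ} (hx : ‖x‖ < 1) :
    ((1 + x) / (1 - x)) ^ (1 / 4 : ℂ) = exp ((log (1 + x) - log (1 - x)) / 4) := by
  have h1 := one_add_re_pos hx
  have h2 := one_add_re_pos (x := -x) (by rwa [norm_neg])
  rw [← sub_eq_add_neg] at h2
  have n1 : 1 + x ≠ 0 := fun h => by simp [h] at h1
  have n2 : 1 - x ≠ 0 := fun h => by simp [h] at h2
  have a1 := abs_lt.1 (abs_arg_lt_pi_div_two_iff.2 (Or.inl h1))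
  have a2 := abs_lt.1 (abs_arg_lt_pi_div_two_iff.2 (Or.inl h2))
  have e : (1 + x) / (1 - x) = exp (log (1 + x) - log (1 - x)) := by
    rw [exp_sub, exp_log n1, exp_log n2]
  rw [cpow_def_of_ne_zero (div_ne_zero n1 n2), e, log_exp]
  · congr 1; ring
  · rw [sub_im, log_im, log_im]; linarith [a1.1, a2.2]
  · rw [sub_im, log_im, log_im]; linarith [a1.2, a2.1]

/-- The exponent `log ((1 + u z) / (1 - u z)) / 4`. -/
def quarterLog (u z : ℂ) : ℂ := (log (1 + u * z) - log (1 - u * z)) / 4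

lemma continuousAt_quarterLog {u : ℂ} (hu : ‖u‖ = 1) {z₀ : ℂ} (hz : ‖z₀‖ < 1) :
    ContinuousAt (quarterLog u) z₀ := by
  have hn : ‖u * z₀‖ < 1 := by rwa [norm_mul, hu, one_mul]
  have h1 := one_add_re_pos hn
  have h2 := one_add_re_pos (x := -(u * z₀)) (by rwa [norm_neg])
  rw [← sub_eq_add_neg] at h2
  refine ContinuousAt.div_const (ContinuousAt.sub (ContinuousAt.clog (by fun_prop) ?_)
    (ContinuousAt.clog (by fun_prop) ?_)) 4
  · exact mem_slitPlane_iff.2 (Or.inl h1)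
  · exact mem_slitPlane_iff.2 (Or.inl h2)

lemma cpow_quarter_I {z : ℂ} (hz : ‖z‖ < 1) :
    ((I - z) / (I + z)) ^ (1 / 4 : ℂ) = exp (quarterLog I z) := by
  have hn : ‖I * z‖ < 1 := by rwa [norm_mul, norm_I, one_mul]
  rw [quarterLog, ← cpow_quarter_eq hn, show I - z = I * (1 + I * z) by
    linear_combination -z * I_sq, show I + z = I * (1 - I * z) by
    linear_combination z * I_sq, mul_div_mul_left _ _ I_ne_zero]

lemma cpow_quarter_neg_I {z : ℂ} (hz : ‖z‖ < 1) :
    ((I + z) / (I - z)) ^ (1 / 4 : ℂ) = exp (quarterLog (-I) z) := by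
  have hn : ‖-I * z‖ < 1 := by rwa [norm_mul, norm_neg, norm_I, one_mul]
  rw [quarterLog, ← cpow_quarter_eq hn, show I - z = I * (1 - -I * z) by
    linear_combination -z * I_sq, show I + z = I * (1 + -I * z) by
    linear_combination z * I_sq, mul_div_mul_left _ _ I_ne_zero]

lemma quarterLog_neg (z : ℂ) : quarterLog (-I) z = -quarterLog I z := by
  rw [quarterLog, quarterLog, neg_mul, sub_neg_eq_add, ← sub_eq_add_neg]
  ring

/-- The two exponentials are inverse to each other, so a cancellation forces `E ^ 4 = 1`, that is
`(1 + i z) / (1 - i z) = 1`, hence `z = 0`. This is where the punctured disk is needed. -/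
lemma exp_quarterLog_ne {z : ℂ} (hz : ‖z‖ < 1) (hz0 : z ≠ 0) {s : ℂ} (hs : s ^ 2 = 1) :
    exp (quarterLog I z) + s * exp (quarterLog (-I) z) ≠ 0 := by
  intro h
  have hn : ‖I * z‖ < 1 := by rwa [norm_mul, norm_I, one_mul]
  have h1 := one_add_re_pos hn
  have h2 := one_add_re_pos (x := -(I * z)) (by rwa [norm_neg])
  rw [← sub_eq_add_neg] at h2
  have n1 : 1 + I * z ≠ 0 := fun h => by simp [h] at h1
  have n2 : 1 - I * z ≠ 0 := fun h => by simp [h] at h2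
  rw [quarterLog_neg] at h
  set E := exp (quarterLog I z) with hE
  have hE0 : E ≠ 0 := exp_ne_zero _
  rw [Complex.exp_neg, ← hE] at h
  have h3 : E ^ 2 = -s := by
    field_simp at h
    linear_combination h
  have h4 : E ^ 4 = 1 := by
    rw [show E ^ 4 = (E ^ 2) ^ 2 by ring, h3, neg_sq, hs]
  rw [hE, ← exp_nat_mul, quarterLog, Nat.cast_ofNat, mul_div_cancel₀ _ (by norm_num : (4 : ℂ) ≠ 0),
    exp_sub, exp_log n1, exp_log n2, div_eq_one_iff_eq n2] at h4
  have h5 : I * z = 0 := by linear_combination h4 / 2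
  exact (mul_ne_zero I_ne_zero hz0) h5

lemma exp_pi_div_two_I : exp ((Real.pi / 2 : ℝ) * I) = I := by
  push_cast
  exact exp_pi_div_two_mul_I

lemma exp_peak_pos (n : ℕ) : exp ((n : ℂ) * ((Real.pi / 2 : ℝ) * I)) = I ^ n := by
  rw [exp_nat_mul, exp_pi_div_two_I]

lemma exp_peak_neg (n : ℕ) :
    exp ((n : ℂ) * ((-(Real.pi / 2) : ℝ) * I)) = I ^ (-(n : ℤ)) := by
  rw [ofReal_neg, neg_mul, mul_neg, Complex.exp_neg, exp_peak_pos, zpow_neg, zpow_natCast]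

/-- The oscillating combination of the contributions of `q = i` and `q = -i`. -/
def twoPeaks (n : ℕ) (a b : ℂ) : ℂ := I ^ (-(n : ℤ)) * a + I ^ (n : ℤ) * b

lemma norm_twoPeaks_le (n : ℕ) (a b : ℂ) : ‖twoPeaks n a b‖ ≤ ‖a‖ + ‖b‖ := by
  refine (norm_add_le _ _).trans ?_
  simp

lemma twoPeaks_sub (n : ℕ) (a b c d : ℂ) :
    twoPeaks n a b - twoPeaks n c d = twoPeaks n (a - c) (b - d) := by
  simp only [twoPeaks]
  ring

/-- Up to a unit factor the combination is `a + (-1) ^ n b`, so it takes only two moduli. -/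
lemma le_norm_twoPeaks (n : ℕ) (a b : ℂ) : min ‖a + b‖ ‖a - b‖ ≤ ‖twoPeaks n a b‖ := by
  have h : twoPeaks n a b = I ^ (-(n : ℤ)) * (a + (-1) ^ n * b) := by
    have hI : (I : ℂ) ^ n * I ^ n = (-1) ^ n := by rw [← mul_pow, I_mul_I]
    have hn : (I : ℂ) ^ n ≠ 0 := pow_ne_zero _ I_ne_zero
    rw [twoPeaks, zpow_neg, zpow_natCast, ← hI]
    field_simp
  rw [h, norm_mul, norm_zpow, norm_I, one_zpow, one_mul]
  rcases Nat.even_or_odd n with he | ho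
  · rw [he.neg_one_pow, one_mul]; exact min_le_left _ _
  · rw [ho.neg_one_pow, neg_one_mul, ← sub_eq_add_neg]; exact min_le_right _ _

lemma tendsto_twoPeaks_sub {ι : Type*} {l : Filter ι} {n : ι → ℕ} {a b : ι → ℂ} {a₀ b₀ : ℂ}
    (ha : Tendsto a l (𝓝 a₀)) (hb : Tendsto b l (𝓝 b₀)) :
    Tendsto (fun i => twoPeaks (n i) (a i) (b i) - twoPeaks (n i) a₀ b₀) l (𝓝 0) := by
  have h : Tendsto (fun i => ‖a i - a₀‖ + ‖b i - b₀‖) l (𝓝 0) := by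
    have h1 := (ha.sub_const a₀).norm.add (hb.sub_const b₀).norm
    simpa using h1
  refine squeeze_zero_norm (fun i => ?_) h
  rw [twoPeaks_sub]
  exact norm_twoPeaks_le _ _ _

/-- Replaces the quotient of limits: numerator and denominator share an oscillating approximation
`B` that has no limit but is bounded away from zero. -/
lemma tendsto_div_of_sub {ι : Type*} {l : Filter ι} {f g B : ι → ℂ} {δ : ℝ} (hδ : 0 < δ)
    (hf : Tendsto (fun i => f i - B i) l (𝓝 0)) (hg : Tendsto (fun i => g i - B i) l (𝓝 0))
    (hB : ∀ i, δ ≤ ‖B i‖) : Tendsto (fun i => f i / g i) l (𝓝 1) := by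
  have hgb : ∀ᶠ i in l, δ / 2 ≤ ‖g i‖ := by
    have h1 : ∀ᶠ i in l, ‖g i - B i‖ < δ / 2 := hg.norm.eventually_lt_const (by simpa using hδ)
    filter_upwards [h1] with i hi
    have h2 := norm_sub_norm_le (B i) (B i - g i)
    rw [sub_sub_cancel, norm_sub_rev (B i)] at h2
    linarith [hB i]
  have hlim : Tendsto (fun i => ‖f i - B i - (g i - B i)‖ / (δ / 2)) l (𝓝 0) := by
    simpa using ((hf.sub hg).norm).div_const (δ / 2)
  rw [tendsto_iff_norm_sub_tendsto_zero]
  refine squeeze_zero' (Eventually.of_forall fun _ => norm_nonneg _) ?_ hlim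
  filter_upwards [hgb] with i hi
  have hpos : 0 < ‖g i‖ := (half_pos hδ).trans_le hi
  have hne : g i ≠ 0 := norm_pos_iff.1 hpos
  rw [show f i / g i - 1 = (f i - B i - (g i - B i)) / g i by field_simp; ring, norm_div]
  gcongr

lemma integral_split_two {f : ℝ → ℂ} (hf : Continuous f) (a b c d e g : ℝ) :
    ∫ x in a..g, f x = (∫ x in a..b, f x) + (∫ x in b..c, f x) + (∫ x in c..d, f x) +
      (∫ x in d..e, f x) + ∫ x in e..g, f x := by
  rw [integral_split hf a b c g, integral_split hf c d e g]
  ring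

/-- The normalised coefficient when the singularities `q = ±i` dominate. -/
theorem tendsto_normalised_I {z₀ : ℂ} (hz : ‖z₀‖ < 1) (hdom : Dominates (-1) 2 z₀) :
    Tendsto (fun p : ℕ × ℂ => 2 * Real.pi * normaliser p.1 (amp (-1) 2 p.2) * Q p.1 p.2 -
      twoPeaks p.1 ((Real.pi * amp (-1) 2 z₀) ^ (1 / 2 : ℂ) * exp (quarterLog I z₀))
        ((Real.pi * amp (-1) 2 z₀) ^ (1 / 2 : ℂ) * exp (quarterLog (-I) z₀)))
      (atTop ×ˢ 𝓝 z₀) (𝓝 0) := by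
  have hadm : Admissible (-1) 2 := Or.inr rfl
  have hre := hdom.re_pos
  have hA := continuousAt_amp hadm.eq_or two_pos hz hre
  have hwin1 := tendsto_window hz hA hre (α₀ := Real.pi / 2) (e₀ := quarterLog I z₀)
    (fun K hK => by
      refine (tendsto_logGen_sub_at_I (Or.inl rfl) hz hK).congr fun p => ?_
      rw [amp_sq]
      push_cast
      rw [mul_comm I, neg_one_mul]
      ring)
  have hwin2 := tendsto_window hz hA hre (α₀ := -(Real.pi / 2)) (e₀ := quarterLog (-I) z₀)
    (fun K hK => by
      refine (tendsto_logGen_sub_at_I (Or.inr rfl) hz hK).congr fun p => ?_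
      rw [amp_sq]
      push_cast
      rw [neg_mul, mul_comm I, neg_mul, neg_one_mul]
      ring)
  have hsmall := eventually_window_small hA hre
  have hbd := eventually_re_bounds hA hre
  have hlt : ∀ᶠ p : ℕ × ℂ in atTop ×ˢ 𝓝 z₀, ‖p.2‖ < 1 :=
    tendsto_snd.norm.eventually_lt_const hz
  set A := amp (-1) 2 with hAdef
  have hpi := Real.pi_gt_three
  have hfacts : ∀ᶠ p : ℕ × ℂ in atTop ×ˢ 𝓝 z₀, 0 < root4 p.1 ∧ 0 < 1 / root4 p.1 ^ 2 ∧
      (A p.2).im / root4 p.1 ^ 2 + 1 / root4 p.1 ^ 2 < 1 ∧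
      -((A p.2).im / root4 p.1 ^ 2) + 1 / root4 p.1 ^ 2 < 1 := by
    filter_upwards [hsmall, hbd] with p hp hq
    have hr := root4_pos hq.1
    refine ⟨hr, by positivity, ?_, ?_⟩
    · linarith [le_abs_self ((A p.2).im / root4 p.1 ^ 2)]
    · linarith [neg_abs_le ((A p.2).im / root4 p.1 ^ 2)]
  have ht1 := tendsto_tail hadm two_pos hz hdom isPeakSet_two (x := fun _ => -Real.pi)
    (y := fun p => -(Real.pi / 2) - (A p.2).im / root4 p.1 ^ 2 - 1 / root4 p.1 ^ 2)
    (by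
      filter_upwards [hfacts] with p hp
      linarith [hp.2.2.1])
    (by
      filter_upwards [hfacts] with p ⟨hr, h0, h1, h2⟩ α hα
      refine ⟨⟨hα.1, by linarith [hα.2]⟩, ?_⟩
      rintro a (rfl | rfl)
      · exact one_le_abs_of_le hr (hα.2.trans (by rw [← hAdef]; linarith))
      · exact one_le_abs_of_le hr hα.2)
  have ht2 := tendsto_tail hadm two_pos hz hdom isPeakSet_two
    (x := fun p => -(Real.pi / 2) - (A p.2).im / root4 p.1 ^ 2 + 1 / root4 p.1 ^ 2)
    (y := fun p => Real.pi / 2 - (A p.2).im / root4 p.1 ^ 2 - 1 / root4 p.1 ^ 2)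
    (by
      filter_upwards [hfacts] with p ⟨hr, h0, h1, h2⟩
      linarith)
    (by
      filter_upwards [hfacts] with p ⟨hr, h0, h1, h2⟩ α hα
      refine ⟨⟨by linarith [hα.1], by linarith [hα.2]⟩, ?_⟩
      rintro a (rfl | rfl)
      · exact one_le_abs_of_le hr hα.2
      · exact one_le_abs_of_ge hr hα.1)
  have ht3 := tendsto_tail hadm two_pos hz hdom isPeakSet_two (y := fun _ => Real.pi)
    (x := fun p => Real.pi / 2 - (A p.2).im / root4 p.1 ^ 2 + 1 / root4 p.1 ^ 2)
    (by
      filter_upwards [hfacts] with p ⟨hr, h0, h1, h2⟩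
      linarith)
    (by
      filter_upwards [hfacts] with p ⟨hr, h0, h1, h2⟩ α hα
      refine ⟨⟨by linarith [hα.1], hα.2⟩, ?_⟩
      rintro a (rfl | rfl)
      · exact one_le_abs_of_ge hr hα.1
      · exact one_le_abs_of_ge hr (le_trans (by rw [← hAdef]; linarith) hα.1))
  rw [← hAdef] at ht1 ht2 ht3
  have hpeaks := tendsto_twoPeaks_sub (n := fun p : ℕ × ℂ => p.1) hwin1 hwin2
  have hsum := ((ht1.add ht2).add ht3).add hpeaks
  rw [add_zero, add_zero, add_zero] at hsum
  refine hsum.congr' ?_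
  filter_upwards [hbd, hlt] with p hp hz1
  have hr := root4_pos hp.1
  have ha : 0 < (A p.2).re := by linarith [hp.2.1]
  have hη : 0 < (A p.2).re / root4 p.1 ^ 2 := by positivity
  have hc := continuous_cauchyIntegrand p.1 hz1 hη
  have hQ := integral_exp_logGen hz1 hη p.1
  change ∫ α in (-Real.pi)..Real.pi,
    cauchyIntegrand p.1 p.2 ((A p.2).re / root4 p.1 ^ 2) α = _ at hQ
  rw [show 2 * Real.pi * normaliser p.1 (A p.2) * Q p.1 p.2 =
    normaliser p.1 (A p.2) * (2 * Real.pi * Q p.1 p.2) by ring, ← hQ, normaliser,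
    integral_split_two hc (-Real.pi)
      (-(Real.pi / 2) - (A p.2).im / root4 p.1 ^ 2 - 1 / root4 p.1 ^ 2)
      (-(Real.pi / 2) - (A p.2).im / root4 p.1 ^ 2 + 1 / root4 p.1 ^ 2)
      (Real.pi / 2 - (A p.2).im / root4 p.1 ^ 2 - 1 / root4 p.1 ^ 2)
      (Real.pi / 2 - (A p.2).im / root4 p.1 ^ 2 + 1 / root4 p.1 ^ 2) Real.pi]
  rw [← add_sub_assoc]
  congr 1
  rw [exp_peak_pos, exp_peak_neg, twoPeaks, zpow_neg, zpow_natCast]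
  have hI : (I : ℂ) ^ p.1 ≠ 0 := pow_ne_zero _ I_ne_zero
  generalize (∫ x in (-Real.pi)..(-(Real.pi / 2) - (A p.2).im / root4 p.1 ^ 2 -
    1 / root4 p.1 ^ 2), cauchyIntegrand p.1 p.2 ((A p.2).re / root4 p.1 ^ 2) x) = J1
  generalize (∫ x in (-(Real.pi / 2) - (A p.2).im / root4 p.1 ^ 2 -
    1 / root4 p.1 ^ 2)..(-(Real.pi / 2) - (A p.2).im / root4 p.1 ^ 2 +
    1 / root4 p.1 ^ 2), cauchyIntegrand p.1 p.2 ((A p.2).re / root4 p.1 ^ 2) x) = J2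
  generalize (∫ x in (-(Real.pi / 2) - (A p.2).im / root4 p.1 ^ 2 +
    1 / root4 p.1 ^ 2)..(Real.pi / 2 - (A p.2).im / root4 p.1 ^ 2 -
    1 / root4 p.1 ^ 2), cauchyIntegrand p.1 p.2 ((A p.2).re / root4 p.1 ^ 2) x) = J3
  generalize (∫ x in (Real.pi / 2 - (A p.2).im / root4 p.1 ^ 2 -
    1 / root4 p.1 ^ 2)..(Real.pi / 2 - (A p.2).im / root4 p.1 ^ 2 +
    1 / root4 p.1 ^ 2), cauchyIntegrand p.1 p.2 ((A p.2).re / root4 p.1 ^ 2) x) = J4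
  generalize (∫ x in (Real.pi / 2 - (A p.2).im / root4 p.1 ^ 2 +
    1 / root4 p.1 ^ 2)..Real.pi, cauchyIntegrand p.1 p.2 ((A p.2).re / root4 p.1 ^ 2) x) = J5
  generalize exp (-(2 * A p.2 * (root4 p.1 : ℂ) ^ 2)) = E
  field_simp
  ring

/-- The asymptotic formula near a point where the singularities `q = ±i` dominate. -/
theorem tendsto_ratio_I {z₀ : ℂ} (hz : ‖z₀‖ < 1) (hz0 : z₀ ≠ 0) (hdom : Dominates (-1) 2 z₀) :
    Tendsto (fun p : ℕ × ℂ => Q p.1 p.2 /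
      ((I ^ (-(p.1 : ℤ)) * ((I - p.2) / (I + p.2)) ^ (1 / 4 : ℂ) +
            I ^ (p.1 : ℤ) * ((I + p.2) / (I - p.2)) ^ (1 / 4 : ℂ)) *
          (Li₂ (-p.2 ^ 2) / (128 * (Real.pi : ℂ) ^ 2 * (p.1 : ℂ) ^ 3)) ^ (1 / 4 : ℂ) *
          exp (((p.1 : ℂ) * Li₂ (-p.2 ^ 2) / 2) ^ (1 / 2 : ℂ))))
      (atTop ×ˢ 𝓝 z₀) (𝓝 1) := by
  have hadm : Admissible (-1) 2 := Or.inr rfl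
  have hre := hdom.re_pos
  have hA := continuousAt_amp hadm.eq_or two_pos hz hre
  have hnum := tendsto_normalised_I hz hdom
  have hpos : 0 < (Real.pi * amp (-1) 2 z₀ : ℂ).re := by
    rw [re_ofReal_mul]; exact mul_pos Real.pi_pos hre
  have hroot : Tendsto (fun p : ℕ × ℂ => (Real.pi * amp (-1) 2 p.2 : ℂ) ^ (1 / 2 : ℂ))
      (atTop ×ˢ 𝓝 z₀) (𝓝 ((Real.pi * amp (-1) 2 z₀) ^ (1 / 2 : ℂ))) :=
    (((continuousAt_const.mul hA).cpow continuousAt_const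
      (mem_slitPlane_iff.2 (Or.inl hpos))).tendsto).comp tendsto_snd
  have hne : (Real.pi * amp (-1) 2 z₀ : ℂ) ^ (1 / 2 : ℂ) ≠ 0 := by
    have h0 : (Real.pi * amp (-1) 2 z₀ : ℂ) ≠ 0 := fun h => by simp [h] at hpos
    simp [cpow_eq_zero_iff, h0]
  have hexp : ∀ u : ℂ, ‖u‖ = 1 → Tendsto (fun p : ℕ × ℂ => exp (quarterLog u p.2))
      (atTop ×ˢ 𝓝 z₀) (𝓝 (exp (quarterLog u z₀))) := fun u hu =>
    ((continuous_exp.tendsto _).comp (continuousAt_quarterLog hu hz).tendsto).comp tendsto_snd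
  have hden := tendsto_twoPeaks_sub (n := fun p : ℕ × ℂ => p.1)
    (hroot.mul (hexp I norm_I)) (hroot.mul (hexp (-I) (by rw [norm_neg, norm_I])))
  set w := (Real.pi * amp (-1) 2 z₀ : ℂ) ^ (1 / 2 : ℂ)
  have hδ : 0 < min ‖w * exp (quarterLog I z₀) + w * exp (quarterLog (-I) z₀)‖
      ‖w * exp (quarterLog I z₀) - w * exp (quarterLog (-I) z₀)‖ := by
    rw [← mul_add, ← mul_sub]
    refine lt_min (norm_pos_iff.2 (mul_ne_zero hne ?_)) (norm_pos_iff.2 (mul_ne_zero hne ?_))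
    · simpa using exp_quarterLog_ne hz hz0 (s := 1) (by norm_num)
    · simpa [sub_eq_add_neg] using exp_quarterLog_ne hz hz0 (s := -1) (by norm_num)
  refine (tendsto_div_of_sub hδ hnum hden fun p => le_norm_twoPeaks p.1 _ _).congr' ?_
  have hlt : ∀ᶠ p : ℕ × ℂ in atTop ×ˢ 𝓝 z₀, ‖p.2‖ < 1 :=
    tendsto_snd.norm.eventually_lt_const hz
  filter_upwards [eventually_re_bounds hA hre, hlt] with p hp hz1
  have ha : 0 < (amp (-1) 2 p.2).re := by linarith [hp.2.1]
  have hLi : Li₂ (-p.2 ^ 2) = 8 * amp (-1) 2 p.2 ^ 2 := by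
    rw [amp_sq, neg_one_mul]
    push_cast
    ring
  have hb : (Li₂ (-p.2 ^ 2) / (128 * (Real.pi : ℂ) ^ 2 * (p.1 : ℂ) ^ 3)) ^ (1 / 4 : ℂ) *
      exp (((p.1 : ℂ) * Li₂ (-p.2 ^ 2) / 2) ^ (1 / 2 : ℂ)) =
      saddleTerm p.1 (amp (-1) 2 p.2) := by
    rw [saddleTerm, hLi]
    congr 2
    · rw [show (128 : ℂ) * (Real.pi : ℂ) ^ 2 * (p.1 : ℂ) ^ 3 =
        8 * (16 * (Real.pi : ℂ) ^ 2 * (p.1 : ℂ) ^ 3) by ring,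
        mul_div_mul_left _ _ (by norm_num)]
    · congr 1
      ring
  have hpi : (Real.pi : ℂ) ≠ 0 := by exact_mod_cast Real.pi_ne_zero
  have hN : 2 * (Real.pi : ℂ) * normaliser p.1 (amp (-1) 2 p.2) ≠ 0 :=
    mul_ne_zero (mul_ne_zero two_ne_zero hpi) (normaliser_ne_zero hp.1 _)
  rw [mul_assoc (_ + _), hb, cpow_quarter_I hz1, cpow_quarter_neg_I hz1,
    ← normaliser_mul_saddleTerm hp.1 ha, ← mul_div_mul_left (Q p.1 p.2) _ hN]
  congr 1
  rw [twoPeaks]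
  ring

/-! ### Uniformity on compact sets and the theorem. -/

/-- Joint convergence in `(n, z)` at each point is local uniform convergence, which compactness
makes uniform. -/
lemma asympOn_of_tendsto {X : Set ℂ} (hX : IsCompact X) {a b : ℕ → ℂ → ℂ}
    (h : ∀ z ∈ X, Tendsto (fun p : ℕ × ℂ => a p.1 p.2 / b p.1 p.2) (atTop ×ˢ 𝓝 z) (𝓝 1)) :
    AsympOn X a b := by
  rw [AsympOn, ← tendstoLocallyUniformlyOn_iff_tendstoUniformlyOn_of_compact hX,
    tendstoLocallyUniformlyOn_iff_forall_tendsto]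
  intro z hz
  have h1 := (h z hz).mono_left (prod_mono_right atTop (nhdsWithin_le_nhds (s := X)))
  rw [Uniform.tendsto_nhds_right] at h1
  exact h1

end OddParts

end

theorem mainTheorem7 (X : Set ℂ) (hX : IsCompact X) :
    (X ⊆ OddParts.phase 1 1 →
      OddParts.AsympOn X OddParts.Q (fun n z =>
        (OddParts.Li₂ z / (32 * (Real.pi : ℂ) ^ 2 * (n : ℂ) ^ 3)) ^ (1 / 4 : ℂ) *
          Complex.exp ((2 * (n : ℂ) * OddParts.Li₂ z) ^ (1 / 2 : ℂ)))) ∧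
    (X ⊆ OddParts.phase 1 2 →
      OddParts.AsympOn X OddParts.Q (fun n z =>
        (-1 : ℂ) ^ n *
          (OddParts.Li₂ (-z) / (32 * (Real.pi : ℂ) ^ 2 * (n : ℂ) ^ 3)) ^ (1 / 4 : ℂ) *
          Complex.exp ((2 * (n : ℂ) * OddParts.Li₂ (-z)) ^ (1 / 2 : ℂ)))) ∧
    (X ⊆ OddParts.phase 1 4 →
      OddParts.AsympOn X OddParts.Q (fun n z =>
        (Complex.I ^ (-(n : ℤ)) * ((Complex.I - z) / (Complex.I + z)) ^ (1 / 4 : ℂ) +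
            Complex.I ^ (n : ℤ) * ((Complex.I + z) / (Complex.I - z)) ^ (1 / 4 : ℂ)) *
          (OddParts.Li₂ (-z ^ 2) / (128 * (Real.pi : ℂ) ^ 2 * (n : ℂ) ^ 3)) ^ (1 / 4 : ℂ) *
          Complex.exp (((n : ℂ) * OddParts.Li₂ (-z ^ 2) / 2) ^ (1 / 2 : ℂ)))) := by
  refine ⟨fun h => OddParts.asympOn_of_tendsto hX fun z hz => ?_,
    fun h => OddParts.asympOn_of_tendsto hX fun z hz => ?_,
    fun h => OddParts.asympOn_of_tendsto hX fun z hz => ?_⟩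
  · exact OddParts.tendsto_ratio_one (h hz).1.1 (OddParts.dominates_of_mem_phase_one_one (h hz))
  · exact OddParts.tendsto_ratio_neg_one (h hz).1.1
      (OddParts.dominates_of_mem_phase_one_two (h hz))
  · exact OddParts.tendsto_ratio_I (h hz).1.1 (h hz).1.2
      (OddParts.dominates_of_mem_phase_one_four (h hz))
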